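/- Languages are subsets of $\{0,1\}^*$. Let $\Sigma_0^p=\Pi_0^p=\mathrm{P}$ and, for $i\ge 1$, $\Sigma_i^p=\mathrm{NP}^{\Sigma_{i-1}^p}$ and $\Pi_i^p=\mathrm{co}\Sigma_i^p=\{L : \overline{L}\in\Sigma_i^p\}$; let $\mathrm{PH}=\bigcup_{i\ge 0}\Sigma_i^p$. For classes $\mathcal C,\mathcal D$ of languages, $\mathrm{P}^{\mathcal C:\mathcal D}$ denotes the class of languages $L$ for which there are $C\in\mathcal C$, $D\in\mathcal D$ and a deterministic polynomial-time oracle Turing machine that accepts exactly $L$ and that, on each input, makes at most one query to $C$ followed by at most one query to $D$. (Polynomial-time oracle machines have a polynomial time bound that does not depend on the oracles.) Let $j,k$ be integers with $0\le j<k-1$. If $$\mathrm{P}^{\Sigma_j^p:\Sigma_k^p}=\mathrm{P}^{\Sigma_{j+1}^p:\Sigma_k^p},$$ then $\Sigma_k^p=\Pi_k^p=\mathrm{PH}$. -/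

import Mathlib

namespace QueryOrder

/-- The contents of a tape cell: blank (`none`), an input symbol `0` / `1`, or one of the further
work symbols in `A`. -/
abbrev Cell (A : Type) : Type := Option (Bool ⊕ A)

/-- The word of bits at the beginning of a list of cells, up to the first cell that holds no bit. -/
def readBits {A : Type} : List (Cell A) → List Bool
  | some (Sum.inl b) :: l => b :: readBits l
  | _ => []

theorem readBits_append_blank {A : Type} (l : List (Cell A)) (n : ℕ) :
    readBits (l ++ List.replicate n default) = readBits l := by
  induction l with
  | nil => cases n <;> rfl
  | cons a l ih =>
    rcases a with _ | b | a
    · rfl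
    · simpa [readBits] using ih
    · rfl

/-- The word written on a tape: the bits from the scanned cell to the right, up to the first cell
that holds no bit. -/
def tapeWord {A : Type} (T : Turing.Tape (Cell A)) : List Bool :=
  T.right₀.liftOn readBits (by
    rintro l _ ⟨n, rfl⟩
    exact (readBits_append_blank l n).symm)

/-- What an oracle Turing machine does in a given state: it stops, accepting or rejecting; or it
asks the oracle with index `i` about the word on its query tape and enters the state `next true` or
`next false` according to the answer; or it makes an ordinary move. For an ordinary move there are
two transition functions `δ false` and `δ true`, between which a nondeterministic machine
chooses; each maps the scanned symbols to a new state and, on every tape, a symbol to be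
written over the scanned one and a head movement (`none`: the head stays). -/
inductive Action (ι Q K A : Type) : Type
  | halt (accept : Bool)
  | query (i : ι) (next : Bool → Q)
  | move (δ : Bool → (K → Cell A) → Q × (K → Cell A × Option Turing.Dir))

/-- A multitape nondeterministic oracle Turing machine, whose oracles are indexed by `ι`. -/
structure OracleTM (ι : Type) : Type 1 where
  /-- the states -/
  Q : Type
  /-- the tapes -/
  K : Type
  /-- the work symbols other than blank, `0` and `1` -/
  A : Type
  [fintypeQ : Fintype Q]
  [fintypeK : Fintype K]
  [decEqK : DecidableEq K]
  [fintypeA : Fintype A]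
  start : Q
  inputTape : K
  queryTape : K
  action : Q → Action ι Q K A

attribute [instance] OracleTM.fintypeQ OracleTM.fintypeK OracleTM.decEqK OracleTM.fintypeA

namespace OracleTM

variable {ι : Type} (M : OracleTM ι)

/-- A configuration: the state, and the tapes with their head positions. -/
structure Cfg where
  state : M.Q
  tape : M.K → Turing.Tape (Cell M.A)

/-- The initial configuration: the head of the input tape scans the first symbol of the input;
all other tapes are blank. -/
def init (x : List Bool) : M.Cfg where
  state := M.start
  tape k := if k = M.inputTape then Turing.Tape.mk₁ (x.map fun b => some (Sum.inl b)) else default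

open Classical in
/-- One step with oracles `O` and nondeterministic choice `b`. A halted configuration is kept. -/
noncomputable def next (O : ι → Set (List Bool)) (b : Bool) (c : M.Cfg) : M.Cfg :=
  match M.action c.state with
  | .halt _ => c
  | .query i q => ⟨q (decide (tapeWord (c.tape M.queryTape) ∈ O i)), c.tape⟩
  | .move δ =>
    let d := δ b fun k => (c.tape k).head
    ⟨d.1, fun k =>
      let T := (c.tape k).write (d.2 k).1
      match (d.2 k).2 with
      | none => T
      | some dir => T.move dir⟩

/-- The configuration after `t` steps on input `x`, on the computation path on which the choice
made in step `t` is `r t`. -/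
noncomputable def run (O : ι → Set (List Bool)) (r : ℕ → Bool) (x : List Bool) : ℕ → M.Cfg
  | 0 => M.init x
  | t + 1 => M.next O (r t) (run O r x t)

/-- The machine never has a choice. -/
def Deterministic : Prop :=
  ∀ q δ, M.action q = .move δ → δ false = δ true

/-- The machine runs in polynomial time: there is a polynomial `p` such that, whatever the oracles
are, each computation path on each input `x` halts within `p(|x|)` steps. -/
def PolyTime : Prop :=
  ∃ p : Polynomial ℕ, ∀ (O : ι → Set (List Bool)) (r : ℕ → Bool) (x : List Bool),
    ∃ t ≤ p.eval x.length, ∃ a, M.action (M.run O r x t).state = .halt a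

/-- The language accepted with oracles `O`: the inputs with an accepting computation path. -/
def lang (O : ι → Set (List Bool)) : Set (List Bool) :=
  {x | ∃ (r : ℕ → Bool) (t : ℕ), M.action (M.run O r x t).state = .halt true}

/-- In step `t` on input `x` and path `r`, the machine queries the oracle with index `i`. -/
def QueriesAt (O : ι → Set (List Bool)) (r : ℕ → Bool) (x : List Bool) (t : ℕ) (i : ι) : Prop :=
  ∃ q, M.action (M.run O r x t).state = .query i q

/-- For a machine with two oracles: on each input it makes at most one query to the oracle
`O false`, followed by at most one query to the oracle `O true`. -/
def OrderedQueries (M : OracleTM Bool) (O : Bool → Set (List Bool)) : Prop :=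
  ∀ r x,
    (∀ i s t, M.QueriesAt O r x s i → M.QueriesAt O r x t i → s = t) ∧
    (∀ s t, M.QueriesAt O r x s false → M.QueriesAt O r x t true → s < t)

end OracleTM

/-- The class P. -/
def P : Set (Set (List Bool)) :=
  {L | ∃ M : OracleTM Empty, M.Deterministic ∧ M.PolyTime ∧ L = M.lang Empty.elim}

/-- The class NP relative to a class: the languages accepted by a nondeterministic polynomial-time
machine with an oracle from `𝒞`. -/
def NPRel (𝒞 : Set (Set (List Bool))) : Set (Set (List Bool)) :=
  {L | ∃ C ∈ 𝒞, ∃ M : OracleTM Unit, M.PolyTime ∧ L = M.lang fun _ => C}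

/-- The class `P^{𝒞 : 𝒟}`: the languages accepted by a deterministic polynomial-time machine that
makes at most one query to an oracle from `𝒞` followed by at most one query to an oracle
from `𝒟`. -/
def POrdered (𝒞 𝒟 : Set (Set (List Bool))) : Set (Set (List Bool)) :=
  {L | ∃ C ∈ 𝒞, ∃ D ∈ 𝒟, ∃ M : OracleTM Bool, M.Deterministic ∧ M.PolyTime ∧
    M.OrderedQueries (fun i => bif i then D else C) ∧ L = M.lang fun i => bif i then D else C}

/-- The classes `Σ_k^p` of the polynomial hierarchy. -/
def SigmaP : ℕ → Set (Set (List Bool))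
  | 0 => P
  | k + 1 => NPRel (SigmaP k)

/-- The classes `Π_k^p` of the polynomial hierarchy. -/
def PiP : ℕ → Set (Set (List Bool))
  | 0 => P
  | k + 1 => {L | Lᶜ ∈ SigmaP (k + 1)}

/-- The polynomial hierarchy. -/
def PH : Set (Set (List Bool)) :=
  ⋃ k, SigmaP k

end QueryOrder

/-! Write k = n + 1, so that j < n. The machine-defined hierarchy is first identified with the one
given by alternating polynomially bounded quantifiers (`SigmaP_eq_QS`). What remains is an easy-hard
argument showing that Σ_k is closed under complement (`QS.compl_mem_of_POrdered_eq`); the collapse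
then follows as usual.

Let L be in Σ_k. Stripping its outer n - j quantifiers leaves questions to a set S in Σ_{j+1}. The
set of pairs (φ, x) for which exactly one of φ ∈ S, x ∈ L holds is in P^{Σ_{j+1}:Σ_k}, so by
hypothesis it is decided by a machine M that queries some C in Σ_j and then some D in Σ_k, each at
most once. Fix x ∉ L.

Easy case: for some short φ, M on (φ, x) receives no negative answer from D. Such a run can be
certified within Σ_k, since both answers of C and the positive answers of D can. As j + 1 < k,
membership of φ in S and in its complement are also in Σ_k, so φ yields a Σ_k-proof of x ∉ L.

Hard case: for every short φ, D is queried and answers no. Replacing D by the empty set does not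
change the run, and as x ∉ L, φ ∈ S holds iff (φ, x) is in the language B of the modified machine.
Both B and its complement are in Σ_{j+1}. With x as its own advice, S may be replaced by B in L,
which saves a quantifier and puts x ∉ L into Σ_k (`QS.exists_replacement`). That all φ are hard
cannot be checked directly; it is checked instead that B agrees with S on short words.
Self-reducibility of S makes this a Π_{j+1} condition (`QS.forall_mem_suffixes_iff`), hence one
within Σ_k. -/

namespace QueryOrder

/-! ### Machines on stacks of bits and their combinators -/

/-- What replaces the top symbol of a stack: nothing, one bit, or two bits (the second component
ends up on top). -/
abbrev Out : Type := Option (Bool × Option Bool)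

/-- The bits, from the top down, that `o` puts in place of the top symbol. -/
def Out.bits : Out → List Bool
  | none => []
  | some (c, none) => [c]
  | some (c, some b) => [b, c]

/-- Keep the top symbol. -/
def Out.keep : Option Bool → Out := Option.map fun b => (b, none)

/-- Push `b` on a stack with top symbol `t`. -/
def Out.push (b : Bool) : Option Bool → Out
  | none => some (b, none)
  | some c => some (c, some b)

@[simp] theorem Out.bits_none : Out.bits none = [] := rfl

@[simp] theorem Out.bits_keep_none : (Out.keep none).bits = [] := rfl

@[simp] theorem Out.bits_keep_some (b : Bool) : (Out.keep (some b)).bits = [b] := rfl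

@[simp] theorem Out.bits_push_none (b : Bool) : (Out.push b none).bits = [b] := rfl

@[simp] theorem Out.bits_push_some (b c : Bool) : (Out.push b (some c)).bits = [b, c] := rfl

theorem Out.bits_keep (l : List Bool) : (Out.keep l.head?).bits ++ l.tail = l := by
  cases l <;> rfl

theorem Out.bits_push (b : Bool) (l : List Bool) :
    (Out.push b l.head?).bits ++ l.tail = b :: l := by
  cases l <;> rfl

/-- The top symbols of the stacks. -/
def tops {V : Type} (s : V → List Bool) : V → Option Bool := fun v => (s v).head?

/-- Replace the top symbols. -/
def applyOut {V : Type} (o : V → Out) (s : V → List Bool) : V → List Bool :=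
  fun v => (o v).bits ++ (s v).tail

theorem applyOut_keep {V : Type} (s : V → List Bool) :
    applyOut (fun v => Out.keep (tops s v)) s = s :=
  funext fun v => Out.bits_keep (s v)

/-- A deterministic machine operating on stacks of bits indexed by `V`. -/
structure StackMachine (V : Type) : Type 1 where
  Q : Type
  [fintypeQ : Fintype Q]
  start : Q
  step : Q → (V → Option Bool) → Option Q × (V → Out)

attribute [instance] StackMachine.fintypeQ

namespace StackMachine

variable {V V' : Type}

/-- One step; the state `none` is final. -/
def next (m : StackMachine V) : Option m.Q × (V → List Bool) → Option m.Q × (V → List Bool)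
  | (none, s) => (none, s)
  | (some q, s) => ((m.step q (tops s)).1, applyOut (m.step q (tops s)).2 s)

/-- Started on stacks `s`, the machine stops within `T` steps with stacks `s'`. -/
def Exec (m : StackMachine V) (T : ℕ) (s s' : V → List Bool) : Prop :=
  ∃ n ≤ T, m.next^[n] (some m.start, s) = (none, s')

theorem Exec.mono {m : StackMachine V} {T T' : ℕ} {s s' : V → List Bool}
    (h : m.Exec T s s') (hT : T ≤ T') : m.Exec T' s s' :=
  let ⟨n, hn, e⟩ := h
  ⟨n, hn.trans hT, e⟩

theorem length_iterate_next_le (m : StackMachine V) (n : ℕ)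
    (c : Option m.Q × (V → List Bool)) (v : V) :
    ((m.next^[n] c).2 v).length ≤ (c.2 v).length + 2 * n := by
  induction n generalizing c with
  | zero => simp
  | succ n ih =>
    rw [Function.iterate_succ_apply]
    refine (ih _).trans ?_
    -- An empty stack can receive two bits while nothing is removed from it.
    have : ((m.next c).2 v).length ≤ (c.2 v).length + 2 := by
      obtain ⟨_ | q, s⟩ := c
      · simp [next]
      · simp only [next, applyOut]
        rcases (m.step q (tops s)).2 v with _ | ⟨c, _ | b⟩ <;> rcases s v with _ | ⟨a, l⟩ <;>
          simp [Out.bits]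
        all_goals omega
    omega

theorem Exec.length_le {m : StackMachine V} {T : ℕ} {s s' : V → List Bool}
    (h : m.Exec T s s') (v : V) : (s' v).length ≤ (s v).length + 2 * T := by
  obtain ⟨n, hn, e⟩ := h
  have := m.length_iterate_next_le n (some m.start, s) v
  rw [e] at this
  simp only at this
  omega

/-- A machine that is embedded in another one carries its computations over. -/
theorem exists_iterate_of_embed {m m' : StackMachine V} (f : m.Q → m'.Q) (ex : Option m'.Q)
    (hf : ∀ q t, m'.step (f q) t = (((m.step q t).1.elim ex fun q' => some (f q')), (m.step q t).2))
    {n : ℕ} {q : m.Q} {s s' : V → List Bool} (h : m.next^[n] (some q, s) = (none, s')) :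
    ∃ n' ≤ n, m'.next^[n'] (some (f q), s) = (ex, s') := by
  induction n generalizing q s with
  | zero => simp at h
  | succ n ih =>
    rw [Function.iterate_succ_apply] at h
    have e : m'.next (some (f q), s) =
        ((m.step q (tops s)).1.elim ex fun q' => some (f q'), (m.next (some q, s)).2) := by
      simp [next, hf]
    rcases h1 : (m.step q (tops s)).1 with _ | q'
    · refine ⟨1, by omega, ?_⟩
      have h2 : m.next (some q, s) = (none, (m.next (some q, s)).2) := by simp [next, h1]
      have h3 : ∀ n t, m.next^[n] (none, t) = (none, t) := fun n t =>
        Function.iterate_fixed rfl n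
      rw [h2, h3] at h
      rw [Function.iterate_one, e, h1]
      simpa using h
    · have h2 : m.next (some q, s) = (some q', (m.next (some q, s)).2) := by simp [next, h1]
      rw [h2] at h
      obtain ⟨n', hn', h'⟩ := ih h
      refine ⟨n' + 1, by omega, ?_⟩
      rw [Function.iterate_succ_apply, e, h1]
      exact h'

/-- The machine that makes a single step. -/
def op (f : (V → Option Bool) → V → Out) : StackMachine V where
  Q := Unit
  start := ()
  step _ t := (none, f t)

theorem op_exec (f : (V → Option Bool) → V → Out) (s : V → List Bool) :
    (op f).Exec 1 s (applyOut (f (tops s)) s) :=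
  ⟨1, le_rfl, rfl⟩

/-- First `m₁`, then `m₂`. -/
def seq (m₁ m₂ : StackMachine V) : StackMachine V where
  Q := m₁.Q ⊕ m₂.Q
  start := .inl m₁.start
  step
    | .inl q, t => ((m₁.step q t).1.elim (some (.inr m₂.start)) fun q' => some (.inl q'),
        (m₁.step q t).2)
    | .inr q, t => ((m₂.step q t).1.elim none fun q' => some (.inr q'), (m₂.step q t).2)

theorem Exec.seq {m₁ m₂ : StackMachine V} {T₁ T₂ : ℕ} {s s' s'' : V → List Bool}
    (h₁ : m₁.Exec T₁ s s') (h₂ : m₂.Exec T₂ s' s'') : (m₁.seq m₂).Exec (T₁ + T₂) s s'' := by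
  obtain ⟨n₁, hn₁, e₁⟩ := h₁
  obtain ⟨n₂, hn₂, e₂⟩ := h₂
  obtain ⟨n₁', hn₁', e₁'⟩ := exists_iterate_of_embed (m' := m₁.seq m₂) Sum.inl
    (some (.inr m₂.start)) (fun _ _ => rfl) e₁
  obtain ⟨n₂', hn₂', e₂'⟩ := exists_iterate_of_embed (m' := m₁.seq m₂) Sum.inr
    none (fun _ _ => rfl) e₂
  refine ⟨n₂' + n₁', by omega, ?_⟩
  rw [Function.iterate_add_apply]
  change (m₁.seq m₂).next^[n₂'] ((m₁.seq m₂).next^[n₁'] (some (.inl m₁.start), s)) = _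
  rw [e₁', e₂']

/-- If the top symbols satisfy `c`, then `m₁`, otherwise `m₂`. -/
def branch (c : (V → Option Bool) → Bool) (m₁ m₂ : StackMachine V) : StackMachine V where
  Q := Option (m₁.Q ⊕ m₂.Q)
  start := none
  step
    | none, t => (some (some (bif c t then .inl m₁.start else .inr m₂.start)),
        fun v => Out.keep (t v))
    | some (.inl q), t => ((m₁.step q t).1.elim none fun q' => some (some (.inl q')),
        (m₁.step q t).2)
    | some (.inr q), t => ((m₂.step q t).1.elim none fun q' => some (some (.inr q')),
        (m₂.step q t).2)

theorem branch_exec {c : (V → Option Bool) → Bool} {m₁ m₂ : StackMachine V} {T : ℕ}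
    {s s' : V → List Bool} (h₁ : c (tops s) = true → m₁.Exec T s s')
    (h₂ : c (tops s) = false → m₂.Exec T s s') : (branch c m₁ m₂).Exec (T + 1) s s' := by
  rcases hc : c (tops s)
  · obtain ⟨n, hn, e⟩ := h₂ hc
    obtain ⟨n', hn', e'⟩ := exists_iterate_of_embed (m' := branch c m₁ m₂)
      (fun q => some (Sum.inr q)) none (fun _ _ => rfl) e
    refine ⟨n' + 1, by omega, ?_⟩
    rw [Function.iterate_succ_apply, ← e']
    simp [next, branch, hc, applyOut_keep]
  · obtain ⟨n, hn, e⟩ := h₁ hc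
    obtain ⟨n', hn', e'⟩ := exists_iterate_of_embed (m' := branch c m₁ m₂)
      (fun q => some (Sum.inl q)) none (fun _ _ => rfl) e
    refine ⟨n' + 1, by omega, ?_⟩
    rw [Function.iterate_succ_apply, ← e']
    simp [next, branch, hc, applyOut_keep]

/-- As long as the top symbols satisfy `c`, run `m`. -/
def loop (c : (V → Option Bool) → Bool) (m : StackMachine V) : StackMachine V where
  Q := Option m.Q
  start := none
  step
    | none, t => (bif c t then some (some m.start) else none, fun v => Out.keep (t v))
    | some q, t => ((m.step q t).1.elim (some none) fun q' => some (some q'), (m.step q t).2)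

theorem loop_exec_false {c : (V → Option Bool) → Bool} {m : StackMachine V}
    {s : V → List Bool} (h : c (tops s) = false) : (loop c m).Exec 1 s s := by
  refine ⟨1, le_rfl, ?_⟩
  simp [next, loop, h, applyOut_keep]

theorem loop_exec_true {c : (V → Option Bool) → Bool} {m : StackMachine V} {T T' : ℕ}
    {s s' s'' : V → List Bool} (h : c (tops s) = true) (h₁ : m.Exec T s s')
    (h₂ : (loop c m).Exec T' s' s'') : (loop c m).Exec (1 + T + T') s s'' := by
  obtain ⟨n, hn, e⟩ := h₁
  obtain ⟨n₂, hn₂, e₂⟩ := h₂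
  obtain ⟨n', hn', e'⟩ := exists_iterate_of_embed (m' := loop c m)
    some (some none) (fun _ _ => rfl) e
  refine ⟨n₂ + (n' + 1), by omega, ?_⟩
  rw [Function.iterate_add_apply, Function.iterate_succ_apply, ← e₂]
  congr 1
  rw [← show _ = (some (loop c m).start, s') from e']
  congr 1
  simp [next, loop, h, applyOut_keep]

/-- `m` operating on some of the stacks in a larger collection. -/
noncomputable def lift (e : V → V') (m : StackMachine V) : StackMachine V' where
  Q := m.Q
  start := m.start
  step q t := ((m.step q (t ∘ e)).1, fun v' =>
    (Function.partialInv e v').elim (Out.keep (t v')) (m.step q (t ∘ e)).2)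

/-- Filling in the untouched stacks with their initial contents semiconjugates `m.next` to the step
of the lifted machine. -/
theorem Exec.lift {m : StackMachine V} {T : ℕ} {s₁ s₂ : V → List Bool} (h : m.Exec T s₁ s₂)
    {e : V → V'} (he : Function.Injective e) {s₁' s₂' : V' → List Bool}
    (h₁ : ∀ v, s₁' (e v) = s₁ v) (h₂ : ∀ v, s₂' (e v) = s₂ v)
    (h₀ : ∀ v', (∀ v, e v ≠ v') → s₂' v' = s₁' v') : (m.lift e).Exec T s₁' s₂' := by
  have hi := he.isPartialInv
  let ext (s : V → List Bool) (v' : V') : List Bool := (Function.partialInv e v').elim (s₁' v') s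
  have ext_e (s v) : ext s (e v) = s v := by
    simp [ext, Function.partialInv_left he]
  have ext_eq (s : V → List Bool) (s' : V' → List Bool) (h₁ : ∀ v, s' (e v) = s v)
      (h₀ : ∀ v', (∀ v, e v ≠ v') → s' v' = s₁' v') : ext s = s' := by
    funext v'
    by_cases hv : ∃ v, e v = v'
    · obtain ⟨v, rfl⟩ := hv
      rw [ext_e, h₁]
    · push Not at hv
      rw [h₀ v' hv]
      rcases h : Function.partialInv e v' with _ | v
      · simp [ext, h]
      · exact absurd ((hi v v').1 h) (hv v)
  obtain ⟨n, hn, e₁⟩ := h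
  refine ⟨n, hn, ?_⟩
  have key : Function.Semiconj (Prod.map id ext : Option m.Q × (V → List Bool) → _)
      m.next (m.lift e).next := by
    rintro ⟨_ | q, s⟩
    · rfl
    · have ht : tops (ext s) ∘ e = tops s := funext fun v => by simp [tops, ext_e]
      simp only [next, Prod.map, StackMachine.lift, ht, id]
      congr 1
      funext v'
      rcases hp : Function.partialInv e v' with _ | v
      · have h4 : ext s v' = s₁' v' := by simp [ext, hp]
        have h5 : ext (applyOut (m.step q (tops s)).2 s) v' = s₁' v' := by simp [ext, hp]
        simp [applyOut, tops, hp, h4, h5, Out.bits_keep]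
      · simp [applyOut, ext, hp]
  have h3 := key.iterate_right n (some m.start, s₁)
  rw [e₁] at h3
  rw [← ext_eq s₁ s₁' h₁ (fun _ _ => rfl), ← ext_eq s₂ s₂' h₂ h₀]
  exact h3.symm

end StackMachine

/-! ### Pairing of words, and stack programs that copy and split -/

theorem eval_mono (p : Polynomial ℕ) {a b : ℕ} (h : a ≤ b) : p.eval a ≤ p.eval b := by
  rw [Polynomial.eval_eq_sum, Polynomial.eval_eq_sum]
  exact Finset.sum_le_sum fun i _ => Nat.mul_le_mul_left _ (Nat.pow_le_pow_left h i)

/-- A pairing function on words. -/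
def pair : List Bool → List Bool → List Bool
  | [], y => false :: y
  | b :: x, y => true :: b :: pair x y

/-- The inverse of `pair`. -/
def unpair : List Bool → List Bool × List Bool
  | true :: b :: z => (b :: (unpair z).1, (unpair z).2)
  | false :: z => ([], z)
  | _ => ([], [])

@[simp] theorem unpair_pair (x y : List Bool) : unpair (pair x y) = (x, y) := by
  induction x with
  | nil => simp [pair, unpair]
  | cons b x ih => simp [pair, unpair, ih]

@[simp] theorem length_pair (x y : List Bool) :
    (pair x y).length = 2 * x.length + 1 + y.length := by
  induction x with
  | nil => simp [pair, Nat.add_comm]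
  | cons b x ih => simp [pair, ih]; omega

theorem length_unpair (z : List Bool) :
    2 * (unpair z).1.length + (unpair z).2.length ≤ z.length := by
  fun_induction unpair z <;> (simp_all; try omega)

namespace StackMachine

section Programs

variable {V : Type} [DecidableEq V]

omit [DecidableEq V] in
theorem op_exec' {f : (V → Option Bool) → V → Out} {s s' : V → List Bool}
    (h : ∀ v, s' v = (f (tops s) v).bits ++ (s v).tail) : (op f).Exec 1 s s' := by
  rw [show s' = applyOut (f (tops s)) s from funext h]
  exact op_exec f s

/-- Move the content of stack `a`, reversed, to each of the stacks in `D`. -/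
def drain (a : V) (D : V → Bool) : StackMachine V :=
  loop (fun t => (t a).isSome) (op fun t v =>
    if v = a then none else if D v then Out.push ((t a).getD false) (t v) else Out.keep (t v))

/-- The final contents are a variable described stack by stack, so that each application can name
them in a convenient form. A round costs two steps, the test and the move. -/
theorem drain_exec {a : V} {D : V → Bool} {s s' : V → List Bool} (ha : s' a = [])
    (h : ∀ v ≠ a, s' v = if D v then (s a).reverse ++ s v else s v) :
    (drain a D).Exec (2 * (s a).length + 1) s s' := by
  induction hl : s a generalizing s with
  | nil =>
    have : s = s' := by
      funext v
      by_cases hv : v = a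
      · rw [hv, ha, hl]
      · simp [h v hv, hl]
    rw [← this]
    exact (loop_exec_false (by simp [tops, hl])).mono (by simp)
  | cons b l ih =>
    refine (loop_exec_true (T := 1) (T' := 2 * l.length + 1)
      (s' := fun v => if v = a then l else if D v then b :: s v else s v)
      (by simp [tops, hl]) (op_exec' fun v => ?_) (ih (fun v hv => ?_) (by simp))).mono
        (by simp; omega)
    · by_cases hv : v = a
      · simp [hv, hl, Out.bits]
      · by_cases hD : D v
        · simp [hv, hD, tops, hl, Out.bits_push]
        · simp [hv, hD, tops, Out.bits_keep]
    · by_cases hD : D v <;> simp [h v hv, hD, hl, hv]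

/-- Split a pair on stack `a`: its second component stays, the first one, reversed, goes to
stack `c`. -/
def unpack (a c : V) : StackMachine V :=
  (loop (fun t => t a == some true) ((op fun t v => if v = a then none else Out.keep (t v)).seq
    (op fun t v => if v = a then none else if v = c then
      (t a).elim (Out.keep (t v)) (fun b => Out.push b (t v)) else Out.keep (t v)))).seq
  (op fun t v => if v = a then none else Out.keep (t v))

/-- In a code `pair x y` each bit of `x` is preceded by `true`, and `false` precedes `y`. A round of
the loop drops a `true` and moves the bit after it; the last operation drops the `false`. -/
theorem unpack_exec {a c : V} (hac : c ≠ a) {s s' : V → List Bool} (ha : s' a = (unpair (s a)).2)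
    (hc : s' c = (unpair (s a)).1.reverse ++ s c) (h : ∀ v, v ≠ a → v ≠ c → s' v = s v) :
    (unpack a c).Exec (3 * (s a).length + 6) s s' := by
  -- The loop leaves `z'` on stack `a`, still with the `false` that ends the first component; on a
  -- malformed word `z'` is empty.
  suffices H : ∀ z s, s a = z → ∃ z', z'.tail = (unpair z).2 ∧
      (loop (fun t => t a == some true) ((op fun t v => if v = a then none else Out.keep (t v)).seq
      (op fun t v => if v = a then none else if v = c then
        (t a).elim (Out.keep (t v)) (fun b => Out.push b (t v)) else Out.keep (t v)))).Exec
        (3 * z.length + 4) s (fun v => if v = a then z' else if v = c then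
          (unpair z).1.reverse ++ s c else s v) by
    obtain ⟨z', hz', H⟩ := H (s a) s rfl
    refine (H.seq (op_exec' (s' := s') fun v => ?_)).mono (by omega)
    by_cases hv : v = a
    · subst hv; simp [ha, hz', Out.bits]
    · by_cases hv' : v = c
      · subst hv'
        simp only [hac, if_false, if_true, tops, hc]
        exact (Out.bits_keep _).symm
      · simp [hv, hv', tops, Out.bits_keep, h]
  clear ha hc h s s'
  intro z
  fun_induction unpair z with
  | case1 b z ih =>
    intro s hs
    obtain ⟨z', hz', H⟩ := ih (fun v => if v = a then z else if v = c then b :: s c else s v)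
      (by simp)
    refine ⟨z', by simp [hz'], ?_⟩
    have H₁ := loop_exec_true (s := s) (by simp [tops, hs])
      ((op_exec' (s' := fun v => if v = a then b :: z else s v) fun v => ?_).seq
        (op_exec' fun v => ?_)) H
    · refine Exec.mono (T := 1 + (1 + 1) + (3 * z.length + 4)) ?_ ?_
      · convert H₁ using 1
        funext v
        by_cases hv : v = a
        · simp [hv]
        · by_cases hv' : v = c
          · subst hv'; simp [hac]
          · simp [hv, hv']
      · simp; omega
    · by_cases hv : v = a
      · simp [hv, hs, Out.bits]
      · simp [hv, tops, Out.bits_keep]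
    · by_cases hv : v = a
      · simp [hv, Out.bits]
      · by_cases hv' : v = c
        · subst hv'; simp [hac, tops, Out.bits_push]
        · simp [hv, hv', tops, Out.bits_keep]
  | case2 z =>
    intro s hs
    refine ⟨false :: z, rfl, ?_⟩
    convert (loop_exec_false (s := s) ?_).mono ?_ using 1
    · funext v
      by_cases hv : v = a
      · simp [hv, hs]
      · by_cases hv' : v = c
        · subst hv'; simp [hac]
        · simp [hv, hv']
    · simp [tops, hs]
    · omega
  | case3 z h1 h2 =>
    intro s hs
    refine ⟨[], rfl, ?_⟩
    have hz : z = [] ∨ z = [true] := by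
      rcases z with _ | ⟨_ | _, _ | ⟨b, z⟩⟩
      · simp
      · exact absurd rfl (h2 [])
      · exact absurd rfl (h2 (b :: z))
      · simp
      · exact absurd rfl (h1 b z)
    rcases hz with rfl | rfl
    · convert (loop_exec_false (s := s) ?_).mono ?_ using 1
      · funext v
        by_cases hv : v = a
        · simp [hv, hs]
        · by_cases hv' : v = c
          · subst hv'; simp [hac]
          · simp [hv, hv']
      · simp [tops, hs]
      · omega
    · refine (loop_exec_true (T := 1 + 1) (T' := 1) (by simp [tops, hs])
        ((op_exec' (s' := fun v => if v = a then [] else s v) fun v => ?_).seq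
        (op_exec' fun v => ?_)) (loop_exec_false ?_)).mono (by simp)
      · by_cases hv : v = a
        · simp [hv, hs, Out.bits]
        · simp [hv, tops, Out.bits_keep]
      · by_cases hv : v = a
        · simp [hv, Out.bits]
        · by_cases hv' : v = c
          · subst hv'; simp [hac, tops, Out.bits_keep]
          · simp [hv, hv', tops, Out.bits_keep]
      · simp [tops]

end Programs

end StackMachine

/-! ### Functions computable in polynomial time -/

open StackMachine

/-- The word `x` on the stack `none`, all other stacks empty. -/
def io {W : Type} (x : List Bool) : Option W → List Bool
  | none => x
  | some _ => []

/-- Three stacks in use, the stacks in `W` empty. -/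
def regs {W : Type} (x y z : List Bool) : Option (W ⊕ Bool) → List Bool
  | none => x
  | some (.inr false) => y
  | some (.inr true) => z
  | some (.inl _) => []

theorem io_eq_regs {W : Type} (x : List Bool) :
    (io x : Option (W ⊕ Bool) → List Bool) = regs x [] [] := by
  funext v
  rcases v with _ | _ | _ | _ <;> rfl

/-- The functions on words that are computable in polynomial time. -/
def FP (f : List Bool → List Bool) : Prop :=
  ∃ (W : Type) (_ : Fintype W) (m : StackMachine (Option W)) (p : Polynomial ℕ),
    ∀ x, m.Exec (p.eval x.length) (io x) (io (f x))

namespace FP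

variable {f g h : List Bool → List Bool}

theorem exists_length_le (hf : FP f) :
    ∃ p : Polynomial ℕ, ∀ x, (f x).length ≤ p.eval x.length := by
  obtain ⟨W, _, m, p, h⟩ := hf
  refine ⟨.X + 2 * p, fun x => ?_⟩
  have := (h x).length_le none
  simpa [io] using this

/-- The machines share the stack `none` but have separate work stacks, so neither disturbs the
other's. The second time bound is applied to the length bound for `g`. -/
theorem comp (hf : FP f) (hg : FP g) : FP fun x => f (g x) := by
  obtain ⟨q, hq⟩ := hg.exists_length_le
  obtain ⟨W₁, _, m₁, p₁, h₁⟩ := hf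
  obtain ⟨W₂, _, m₂, p₂, h₂⟩ := hg
  refine ⟨W₁ ⊕ W₂, inferInstance,
    (m₂.lift (Option.map .inr)).seq (m₁.lift (Option.map .inl)), p₂ + p₁.comp q, fun x => ?_⟩
  rw [Polynomial.eval_add, Polynomial.eval_comp]
  refine Exec.seq (s' := io (g x)) ?_ ?_
  · refine (h₂ x).lift (Option.map_injective Sum.inr_injective) ?_ ?_ ?_
    · rintro (_ | _) <;> rfl
    · rintro (_ | _) <;> rfl
    · rintro (_ | _ | _) hv
      · exact absurd rfl (hv none)
      · rfl
      · rfl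
  · refine ((h₁ (g x)).mono (eval_mono _ (hq x))).lift
      (Option.map_injective Sum.inl_injective) ?_ ?_ ?_
    · rintro (_ | _) <;> rfl
    · rintro (_ | _) <;> rfl
    · rintro (_ | _ | _) hv
      · exact absurd rfl (hv none)
      · rfl
      · rfl

theorem of_out (o : Option Bool → Out) : FP fun x => (o x.head?).bits ++ x.tail := by
  refine ⟨Empty, inferInstance, op fun t v => o (t v), 1, fun x => ?_⟩
  rw [Polynomial.eval_one]
  refine op_exec' ?_
  rintro (_ | ⟨⟨⟩⟩)
  rfl

theorem id : FP fun x => x := by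
  simpa [Out.bits_keep] using of_out Out.keep

theorem tail : FP List.tail := by
  simpa [Out.bits] using of_out fun _ => none

theorem cons (b : Bool) (hf : FP f) : FP fun x => b :: f x := by
  have : FP fun x => b :: x := by simpa [Out.bits_push] using of_out (Out.push b)
  exact this.comp hf

theorem const (l : List Bool) : FP fun _ => l := by
  induction l with
  | nil =>
    refine ⟨Empty, inferInstance, drain none fun _ => false, 2 * .X + 1, fun x => ?_⟩
    refine (drain_exec rfl ?_).mono (by simp [io])
    rintro (_ | ⟨⟨⟩⟩) hv
    simp at hv
  | cons b l ih => exact ih.cons b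

theorem fst : FP fun z => (unpair z).1 := by
  refine ⟨Empty ⊕ Bool, inferInstance, ((unpack none (some (.inr false))).seq
    (drain none fun _ => false)).seq (drain (some (.inr false)) fun v => v.isNone),
    10 * .X + 10, fun x => ?_⟩
  have := length_unpair x
  rw [io_eq_regs, io_eq_regs]
  refine (((unpack_exec (s' := regs (unpair x).2 (unpair x).1.reverse []) (by simp)
    (by simp [regs]) (by simp [regs]) ?_).seq
    (drain_exec (s' := regs [] (unpair x).1.reverse []) (by simp [regs]) ?_)).seq
    (drain_exec (by simp [regs]) ?_)).mono ?_
  · rintro (_ | _ | _ | _) <;> simp [regs]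
  · rintro (_ | _ | _ | _) <;> simp [regs]
  · rintro (_ | _ | _ | _) <;> simp [regs]
  · simp [regs]; omega

theorem snd : FP fun z => (unpair z).2 := by
  refine ⟨Empty ⊕ Bool, inferInstance, (unpack none (some (.inr false))).seq
    (drain (some (.inr false)) fun _ => false), 10 * .X + 10, fun x => ?_⟩
  have := length_unpair x
  rw [io_eq_regs, io_eq_regs]
  refine ((unpack_exec (s' := regs (unpair x).2 (unpair x).1.reverse []) (by simp)
    (by simp [regs]) (by simp [regs]) ?_).seq
    (drain_exec (by simp [regs]) ?_)).mono ?_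
  · rintro (_ | _ | _ | _) <;> simp [regs]
  · rintro (_ | _ | _ | _) <;> simp [regs]
  · simp [regs]; omega

theorem ite_head (hf : FP f) (hg : FP g) :
    FP fun x => if x.head? = some true then f x else g x := by
  obtain ⟨W₁, _, m₁, p₁, h₁⟩ := hf
  obtain ⟨W₂, _, m₂, p₂, h₂⟩ := hg
  refine ⟨W₁ ⊕ W₂, inferInstance, branch (fun t => t none == some true)
    (m₁.lift (Option.map .inl)) (m₂.lift (Option.map .inr)), p₁ + p₂ + 1, fun x => ?_⟩
  rw [Polynomial.eval_add, Polynomial.eval_one, Polynomial.eval_add]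
  refine branch_exec (fun hx => ?_) (fun hx => ?_)
  · replace hx : x.head? = some true := by simpa [tops, io] using hx
    simp only [hx, if_true]
    refine ((h₁ x).mono (Nat.le_add_right _ _)).lift
      (Option.map_injective Sum.inl_injective) ?_ ?_ ?_
    · rintro (_ | _) <;> rfl
    · rintro (_ | _) <;> rfl
    · rintro (_ | _ | _) hv
      · exact absurd rfl (hv none)
      · rfl
      · rfl
  · replace hx : ¬ x.head? = some true := by simpa [tops, io] using hx
    simp only [hx, if_false]
    refine ((h₂ x).mono (Nat.le_add_left _ _)).lift
      (Option.map_injective Sum.inr_injective) ?_ ?_ ?_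
    · rintro (_ | _) <;> rfl
    · rintro (_ | _) <;> rfl
    · rintro (_ | _ | _) hv
      · exact absurd rfl (hv none)
      · rfl
      · rfl

/-- The input is copied to `none` and `b` by way of `c`; then `f` is computed on `b` and `g` on
`none`. The separator is pushed on `g x`, and the bits of `f x`, last one first, are pushed on top,
each followed by `true`. -/
theorem pair (hf : FP f) (hg : FP g) : FP fun x => pair (f x) (g x) := by
  classical
  obtain ⟨q, hq⟩ := hf.exists_length_le
  obtain ⟨W₁, _, m₁, p₁, h₁⟩ := hf
  obtain ⟨W₂, _, m₂, p₂, h₂⟩ := hg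
  let b : Option ((W₁ ⊕ W₂) ⊕ Bool) := some (.inr false)
  let c : Option ((W₁ ⊕ W₂) ⊕ Bool) := some (.inr true)
  let e₁ : Option W₁ → Option ((W₁ ⊕ W₂) ⊕ Bool) := fun v => v.elim b fun w => some (.inl (.inl w))
  let e₂ : Option W₂ → Option ((W₁ ⊕ W₂) ⊕ Bool) := fun v => v.elim none fun w => some (.inl (.inr w))
  let lp : StackMachine (Option ((W₁ ⊕ W₂) ⊕ Bool)) := loop (fun t => (t c).isSome) ((op fun t v =>
      if v = c then none else if v = none then
        Out.push ((t c).getD false) (t v) else Out.keep (t v)).seq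
      (op fun t v => if v = none then Out.push true (t v) else Out.keep (t v)))
  have hlp : ∀ x y : List Bool, lp.Exec (3 * x.length + 1) (regs y [] x)
      (regs (x.foldl (fun l b => true :: b :: l) y) [] []) := by
    intro x
    induction x with
    | nil => exact fun y => (loop_exec_false (by simp [tops, regs, c])).mono (by simp)
    | cons d x ih =>
      intro y
      refine (loop_exec_true (by simp [tops, regs, c]) ((op_exec' (s' := regs (d :: y) [] x) ?_).seq
        (op_exec' ?_)) (ih _)).mono (by simp; omega)
      · rintro (_ | _ | _ | _) <;> simp [regs, tops, c, Out.bits_push]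
      · rintro (_ | _ | _ | _) <;> simp [regs, tops, Out.bits_keep]
  have hfold : ∀ x y, x.reverse.foldl (fun l b => true :: b :: l) (false :: y) =
      QueryOrder.pair x y := by
    intro x y
    induction x with
    | nil => rfl
    | cons d x ih => rw [List.reverse_cons, List.foldl_append, ih]; rfl
  refine ⟨(W₁ ⊕ W₂) ⊕ Bool, inferInstance, ((((((drain none fun v => decide (v = c)).seq
    (drain c fun v => decide (v = none) || decide (v = b))).seq (m₁.lift e₁)).seq
    (m₂.lift e₂)).seq (op fun t v => if v = none then Out.push false (t v) else Out.keep (t v))).seq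
    (drain b fun v => decide (v = c))).seq lp,
    2 * .X + 1 + (2 * .X + 1) + p₁ + p₂ + 1 + (2 * q + 1) + (3 * q + 1), fun x => ?_⟩
  rw [io_eq_regs, io_eq_regs]
  refine Exec.mono ((((((Exec.seq (s' := regs [] [] x.reverse) (drain_exec ?_ ?_)
    (drain_exec (s' := regs x x []) ?_ ?_)).seq
    ((h₁ x).lift (s₂' := regs x (f x) []) ?_ ?_ ?_ ?_)).seq
    ((h₂ x).lift (s₂' := regs (g x) (f x) []) ?_ ?_ ?_ ?_)).seq
    (op_exec' (s' := regs (false :: g x) (f x) []) ?_)).seq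
    (drain_exec (s' := regs (false :: g x) [] (f x).reverse) ?_ ?_)).seq
    ((hlp (f x).reverse (false :: g x)) |> (hfold (f x) (g x) ▸ ·))) ?_
  · rfl
  · rintro (_ | _ | _ | _) <;> simp [regs, c]
  · rfl
  · rintro (_ | _ | _ | _) <;> simp [regs, c, b]
  · rintro (_ | _) (_ | _) h <;> simp_all [e₁, b]
  · rintro (_ | _) <;> rfl
  · rintro (_ | _) <;> rfl
  · rintro (_ | (_ | _) | _ | _) h
    · rfl
    · rfl
    · rfl
    · exact absurd rfl (h none)
    · rfl
  · rintro (_ | _) (_ | _) h <;> simp_all [e₂]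
  · rintro (_ | _) <;> rfl
  · rintro (_ | _) <;> rfl
  · rintro (_ | (_ | _) | _ | _) h
    · exact absurd rfl (h none)
    · rfl
    · rfl
    · rfl
    · rfl
  · rintro (_ | _ | _ | _) <;> simp [regs, tops, Out.bits_push, Out.bits_keep]
  · rfl
  · rintro (_ | _ | _ | _) <;> simp [regs, c, b]
  · have := hq x
    simp [regs, b, c]
    omega

/-- Iterating a polynomial-time body takes polynomial time only if intermediate results stay short;
hence the bound on the fold over every prefix. -/
theorem foldl_cons (hg : FP g) {xs a : List Bool → List Bool} (hxs : FP xs) (ha : FP a)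
    (q : Polynomial ℕ) (hq : ∀ x l, l <+: xs x →
      (l.foldl (fun acc b => g (b :: acc)) (a x)).length ≤ q.eval x.length) :
    FP fun x => (xs x).foldl (fun acc b => g (b :: acc)) (a x) := by
  classical
  obtain ⟨q₀, hq₀⟩ := (hxs.pair ha).exists_length_le
  obtain ⟨W₀, _, m₀, p₀, h₀⟩ := hxs.pair ha
  obtain ⟨W, _, m, p, h⟩ := hg
  let b : Option ((W₀ ⊕ W) ⊕ Bool) := some (.inr false)
  let c : Option ((W₀ ⊕ W) ⊕ Bool) := some (.inr true)
  let e₀ : Option W₀ → Option ((W₀ ⊕ W) ⊕ Bool) := Option.map (.inl ∘ .inl)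
  let e : Option W → Option ((W₀ ⊕ W) ⊕ Bool) := Option.map (.inl ∘ .inr)
  let lp : StackMachine (Option ((W₀ ⊕ W) ⊕ Bool)) := loop (fun t => (t c).isSome) ((op fun t v =>
      if v = c then none else if v = none then
        Out.push ((t c).getD false) (t v) else Out.keep (t v)).seq (m.lift e))
  have hlp : ∀ (N : ℕ) (x y : List Bool),
      (∀ l, l <+: x → (l.foldl (fun acc b => g (b :: acc)) y).length ≤ N) →
      lp.Exec ((2 + p.eval (N + 1)) * x.length + 1) (regs y [] x)
      (regs (x.foldl (fun acc b => g (b :: acc)) y) [] []) := by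
    intro N x
    induction x with
    | nil => exact fun y _ => (loop_exec_false (by simp [tops, regs, c])).mono (by simp)
    | cons d x ih =>
      intro y hy
      refine (loop_exec_true (by simp [tops, regs, c]) ((op_exec' (s' := regs (d :: y) [] x) ?_).seq
        (((h (d :: y)).mono (eval_mono p (b := N + 1) ?_)).lift ?_ ?_ ?_ ?_))
        (ih (g (d :: y)) fun l hl => ?_)).mono (by rw [List.length_cons]; ring_nf; omega)
      · rintro (_ | _ | _ | _) <;> simp [regs, tops, c, Out.bits_push]
      · have := hy [] (List.nil_prefix)
        simpa using this
      · exact Option.map_injective (Sum.inl_injective.comp Sum.inr_injective)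
      · rintro (_ | _) <;> rfl
      · rintro (_ | _) <;> rfl
      · rintro (_ | (_ | _) | _ | _) hv
        · exact absurd rfl (hv none)
        all_goals rfl
      · exact hy (d :: l) (List.cons_prefix_cons.2 ⟨rfl, hl⟩)
  refine ⟨(W₀ ⊕ W) ⊕ Bool, inferInstance,
    (((m₀.lift e₀).seq (unpack none b)).seq (drain b fun v => decide (v = c))).seq lp,
    p₀ + (3 * q₀ + 6) + (2 * q₀ + 1) + ((2 + p.comp (q + 1)) * q₀ + 1), fun x => ?_⟩
  rw [io_eq_regs, io_eq_regs]
  have h1 := hq₀ x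
  rw [length_pair] at h1
  refine Exec.mono (((((h₀ x).lift (s₂' := regs (QueryOrder.pair (xs x) (a x)) [] []) ?_ ?_ ?_ ?_).seq
    (unpack_exec (s' := regs (a x) (xs x).reverse []) ?_ ?_ ?_
    ?_)).seq (drain_exec (s' := regs (a x) [] (xs x)) ?_ ?_)).seq
    (hlp (q.eval x.length) (xs x) (a x) (hq x))) ?_
  · exact Option.map_injective (Sum.inl_injective.comp Sum.inl_injective)
  · rintro (_ | _) <;> rfl
  · rintro (_ | _) <;> rfl
  · rintro (_ | (_ | _) | _ | _) hv
    · exact absurd rfl (hv none)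
    all_goals rfl
  · simp [b]
  · simp [regs]
  · simp [regs, b]
  · rintro (_ | _ | _ | _) <;> simp [regs, b]
  · rfl
  · rintro (_ | _ | _ | _) <;> simp [regs, c, b]
  · have h2 : (2 + p.eval (q.eval x.length + 1)) * (xs x).length ≤
        (2 + p.eval (q.eval x.length + 1)) * q₀.eval x.length :=
      Nat.mul_le_mul_left _ (by omega)
    simp [regs, b, Polynomial.eval_comp]
    omega

end FP

/-! ### Stack machines simulated by Turing machines -/

/-- What a nondeterministic oracle stack machine does in a given state. -/
inductive StackAction (ι V Q : Type) : Type
  | halt (accept : Bool)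
  | query (i : ι) (next : Bool → Q)
  | move (δ : Bool → (V → Option Bool) → Q × (V → Out))

/-- A nondeterministic oracle machine operating on stacks of bits. The stack `none` holds the input
and the queries. -/
structure StackOracleMachine (ι : Type) : Type 1 where
  Q : Type
  W : Type
  [fintypeQ : Fintype Q]
  [fintypeW : Fintype W]
  start : Q
  action : Q → StackAction ι (Option W) Q

attribute [instance] StackOracleMachine.fintypeQ StackOracleMachine.fintypeW

namespace StackOracleMachine

variable {ι : Type} (G : StackOracleMachine ι)

/-- A configuration. -/
abbrev Cfg : Type := G.Q × (Option G.W → List Bool)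

open Classical in
/-- One step with oracles `O` and nondeterministic choice `b`. -/
noncomputable def next (O : ι → Set (List Bool)) (b : Bool) (c : G.Cfg) : G.Cfg :=
  match G.action c.1 with
  | .halt _ => c
  | .query i q => (q (decide (c.2 none ∈ O i)), c.2)
  | .move δ => ((δ b (tops c.2)).1, applyOut (δ b (tops c.2)).2 c.2)

/-- The configuration `t` steps after the configuration `c`. -/
noncomputable def runFrom (O : ι → Set (List Bool)) (r : ℕ → Bool) (c : G.Cfg) : ℕ → G.Cfg
  | 0 => c
  | t + 1 => G.next O (r t) (runFrom O r c t)

/-- The configuration after `t` steps on input `x`. -/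
noncomputable def run (O : ι → Set (List Bool)) (r : ℕ → Bool) (x : List Bool) (t : ℕ) : G.Cfg :=
  G.runFrom O r (G.start, io x) t

variable {G} {O : ι → Set (List Bool)} {r : ℕ → Bool} {c : G.Cfg}

theorem runFrom_add (a b : ℕ) :
    G.runFrom O r c (a + b) = G.runFrom O (fun t => r (a + t)) (G.runFrom O r c a) b := by
  induction b with
  | zero => rfl
  | succ b ih => rw [← Nat.add_assoc, runFrom, ih, runFrom]

theorem runFrom_eq_of_halt {b : Bool} (h : G.action c.1 = .halt b) (t : ℕ) :
    G.runFrom O r c t = c := by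
  induction t with
  | zero => rfl
  | succ t ih => rw [runFrom, ih, next, h]

theorem runFrom_eq_of_halt_of_le {b : Bool} {s t : ℕ}
    (h : G.action (G.runFrom O r c s).1 = .halt b) (hst : s ≤ t) :
    G.runFrom O r c t = G.runFrom O r c s := by
  obtain ⟨d, rfl⟩ := Nat.exists_eq_add_of_le hst
  rw [runFrom_add, runFrom_eq_of_halt h]

theorem halt_unique {b b' : Bool} {s t : ℕ}
    (h : G.action (G.runFrom O r c s).1 = .halt b)
    (h' : G.action (G.runFrom O r c t).1 = .halt b') : b = b' := by
  rcases le_total s t with hst | hst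
  · rw [runFrom_eq_of_halt_of_le h hst, h] at h'
    simpa using h'
  · rw [runFrom_eq_of_halt_of_le h' hst, h'] at h
    simpa using h.symm

/-- A stack machine embedded in an oracle stack machine. -/
theorem exists_runFrom_of_embed {m : StackMachine (Option G.W)} (f : m.Q → G.Q) (qex : G.Q)
    (hf : ∀ q, G.action (f q) = .move fun _ t => ((m.step q t).1.elim qex f, (m.step q t).2))
    {T : ℕ} {s s' : Option G.W → List Bool} (h : m.Exec T s s') :
    ∃ n ≤ T, ∀ O r, G.runFrom O r (f m.start, s) n = (qex, s') := by
  obtain ⟨n, hn, e⟩ := h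
  suffices H : ∀ n q s, m.next^[n] (some q, s) = (none, s') →
      ∃ n' ≤ n, ∀ O r, G.runFrom O r (f q, s) n' = (qex, s') by
    obtain ⟨n', hn', H⟩ := H n _ _ e
    exact ⟨n', hn'.trans hn, H⟩
  clear e hn n
  intro n
  induction n with
  | zero => intro q s h; simp at h
  | succ n ih =>
    intro q s h
    rw [Function.iterate_succ_apply] at h
    have e (O r) : G.runFrom O r (f q, s) 1 =
        ((m.step q (tops s)).1.elim qex f, (m.next (some q, s)).2) := by
      simp [runFrom, next, hf, StackMachine.next]
    rcases h1 : (m.step q (tops s)).1 with _ | q'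
    · refine ⟨1, by omega, fun O r => ?_⟩
      have h2 : m.next (some q, s) = (none, (m.next (some q, s)).2) := by
        simp [StackMachine.next, h1]
      have h3 : ∀ n t, m.next^[n] (none, t) = (none, t) := fun n t =>
        Function.iterate_fixed rfl n
      rw [h2, h3] at h
      rw [e, h1]
      simpa using h
    · have h2 : m.next (some q, s) = (some q', (m.next (some q, s)).2) := by
        simp [StackMachine.next, h1]
      rw [h2] at h
      obtain ⟨n', hn', h'⟩ := ih _ _ h
      refine ⟨1 + n', by omega, fun O r => ?_⟩
      rw [runFrom_add, e, h1]
      exact h' _ _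

variable (G)

/-- There is never a choice. -/
def Deterministic : Prop :=
  ∀ q δ, G.action q = .move δ → δ false = δ true

/-- Polynomial time, whatever the oracles. -/
def PolyTime : Prop :=
  ∃ p : Polynomial ℕ, ∀ (O : ι → Set (List Bool)) (r : ℕ → Bool) (x : List Bool),
    ∃ t ≤ p.eval x.length, ∃ a, G.action (G.run O r x t).1 = .halt a

/-- The accepted language. -/
def lang (O : ι → Set (List Bool)) : Set (List Bool) :=
  {x | ∃ r t, G.action (G.run O r x t).1 = .halt true}

/-- The symbol to be written, and the head movement, in the first of two steps that simulate
a stack operation. -/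
def writeMove : Out → Cell Empty × Option Turing.Dir
  | none => (none, some .right)
  | some (c, none) => (some (.inl c), none)
  | some (c, some _) => (some (.inl c), some .left)

/-- The symbol to be written in the second step. -/
def pending : Out → Option Bool
  | some (_, some b) => some b
  | _ => none

/-- The bit in a cell. -/
def cellBit : Cell Empty → Option Bool
  | some (.inl b) => some b
  | _ => none

open Classical in
/-- A Turing machine that simulates `G`, using two steps for one step of `G`. -/
noncomputable def toTM : OracleTM ι where
  Q := G.Q × Option (Option G.W → Option Bool)
  K := Option G.W
  A := Empty
  start := (G.start, none)
  inputTape := none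
  queryTape := none
  action
    | (q, none) => match G.action q with
      | .halt b => .halt b
      | .query i n => .query i fun b => (n b, some fun _ => none)
      | .move δ => .move fun b h => (((δ b fun v => cellBit (h v)).1,
          some fun v => pending ((δ b fun v => cellBit (h v)).2 v)),
          fun v => writeMove ((δ b fun v => cellBit (h v)).2 v))
    | (q, some w) => .move fun _ h => ((q, none),
        fun v => ((w v).elim (h v) fun b => some (.inl b), none))

/-- The tape that represents a stack. -/
def stackTape (l : List Bool) : Turing.Tape (Cell Empty) :=
  Turing.Tape.mk₁ (l.map fun b => some (Sum.inl b))

theorem cellBit_head_stackTape (l : List Bool) : cellBit (stackTape l).head = l.head? := by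
  cases l <;> rfl

theorem tapeWord_stackTape (l : List Bool) : tapeWord (stackTape l) = l := by
  have h1 : ∀ l : List Bool,
      readBits (l.map fun b => (some (Sum.inl b) : Cell Empty)) = l := by
    intro l
    induction l with
    | nil => rfl
    | cons b l ih => simp [readBits, ih]
  have h2 : (stackTape l).right₀ =
      Turing.ListBlank.mk (l.map fun b => (some (Sum.inl b) : Cell Empty)) := by
    simp [stackTape, Turing.Tape.mk₁, Turing.Tape.mk₂]
  rw [tapeWord, h2]
  exact h1 l

/-- Popping leaves a blank to the left of the head, which must not be distinguished from an empty
half-tape. -/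
theorem mk_blank {Γ : Type} :
    Turing.ListBlank.mk [(none : Option Γ)] = Turing.ListBlank.mk [] :=
  (Quotient.sound (Or.inl ⟨1, rfl⟩)).symm

/-- A head movement that may be absent. -/
def moveOpt {Γ : Type} [Inhabited Γ] (d : Option Turing.Dir) (T : Turing.Tape Γ) :
    Turing.Tape Γ :=
  match d with
  | none => T
  | some dir => T.move dir

/-- The scanned cell is the top of the stack. A stack operation may change two cells, so the lower
bit is written first, the head moves left, and the second step writes the bit above. -/
theorem stackTape_op (o : Out) (l : List Bool) (T : Turing.Tape (Cell Empty))
    (hT : T = moveOpt (writeMove o).2 ((stackTape l).write (writeMove o).1)) :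
    T.write ((pending o).elim T.head fun b => some (.inl b)) = stackTape (o.bits ++ l.tail) := by
  subst hT
  rcases o with _ | ⟨c, _ | b⟩ <;> rcases l with _ | ⟨a, l⟩ <;>
    simp [stackTape, writeMove, pending, moveOpt, Out.bits, Turing.Tape.mk₁, Turing.Tape.mk₂,
      Turing.Tape.mk', Turing.Tape.write, Turing.Tape.move, mk_blank]

/-- The configuration of the Turing machine that represents `c`. -/
noncomputable def toCfg (c : G.Cfg) : G.toTM.Cfg :=
  ⟨(c.1, none), fun v => stackTape (c.2 v)⟩

theorem init_toTM (x : List Bool) : G.toTM.init x = G.toCfg (G.start, io x) := by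
  have : ∀ v, (G.toTM.init x).tape v = stackTape ((io x : Option G.W → List Bool) v) := by
    rintro (_ | w)
    · simp [OracleTM.init, toTM, stackTape, io]
      rfl
    · simp only [OracleTM.init, toTM, stackTape, io]
      rfl
  rw [toCfg, ← funext this]
  rfl

theorem toTM_next_next (b b' : Bool) (c : G.Cfg) :
    G.toTM.next O b' (G.toTM.next O b (G.toCfg c)) = G.toCfg (G.next O b c) := by
  obtain ⟨q, s⟩ := c
  rcases h : G.action q with a | ⟨i, n⟩ | δ
  · simp [OracleTM.next, toCfg, toTM, next, h]
  · have hq : tapeWord (stackTape (s none)) = s none := tapeWord_stackTape _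
    simp [OracleTM.next, toCfg, toTM, next, h]
    congr 1
    exact congrArg (fun b => (n b, none)) (decide_eq_decide.2 (Iff.of_eq (congrArg (· ∈ O i) hq)))
  · simp [OracleTM.next, toCfg, toTM, next, h, cellBit_head_stackTape]
    congr 1
    funext k
    exact stackTape_op _ _ _ rfl

theorem run_toTM (x : List Bool) (t : ℕ) :
    G.toTM.run O r x (2 * t) = G.toCfg (G.run O (fun t => r (2 * t)) x t) := by
  induction t with
  | zero => exact G.init_toTM x
  | succ t ih =>
    rw [Nat.mul_succ, OracleTM.run, OracleTM.run, ih, toTM_next_next]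
    rfl

theorem action_toTM_halt {x : List Bool} {n : ℕ} {b : Bool}
    (h : G.toTM.action (G.toTM.run O r x n).state = .halt b) :
    G.action (G.run O (fun t => r (2 * t)) x (n / 2)).1 = .halt b := by
  obtain ⟨t, rfl | rfl⟩ := n.even_or_odd'
  · rw [run_toTM] at h
    rw [Nat.mul_div_cancel_left _ two_pos]
    generalize G.run O _ x t = c at h ⊢
    simp only [toCfg, toTM] at h
    rcases h' : G.action c.1 with a | ⟨i, n⟩ | δ <;> simp [h'] at h ⊢
    exact h
  · rw [OracleTM.run, run_toTM] at h
    rw [show (2 * t + 1) / 2 = t by omega]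
    generalize G.run O _ x t = c at h ⊢
    rcases h' : G.action c.1 with a | ⟨i, n⟩ | δ <;>
      simp [OracleTM.next, toCfg, toTM, h'] at h ⊢
    exact h

theorem action_toTM_query {x : List Bool} {n : ℕ} {i : ι}
    (h : G.toTM.QueriesAt O r x n i) :
    ∃ t q, n = 2 * t ∧ G.action (G.run O (fun t => r (2 * t)) x t).1 = .query i q := by
  obtain ⟨q, h⟩ := h
  obtain ⟨t, rfl | rfl⟩ := n.even_or_odd'
  · rw [run_toTM] at h
    generalize hc : G.run O _ x t = c at h
    simp only [toCfg, toTM] at h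
    rcases h' : G.action c.1 with a | ⟨i, n⟩ | δ <;> simp [h'] at h
    obtain ⟨rfl, -⟩ := h
    exact ⟨t, n, rfl, by rw [hc, h']⟩
  · rw [OracleTM.run, run_toTM] at h
    generalize G.run O _ x t = c at h
    rcases h' : G.action c.1 with a | ⟨i, n⟩ | δ <;>
      simp [OracleTM.next, toCfg, toTM, h'] at h

theorem toTM_action_of_halt {x : List Bool} {t : ℕ} {b : Bool}
    (h : G.action (G.run O (fun t => r (2 * t)) x t).1 = .halt b) :
    G.toTM.action (G.toTM.run O r x (2 * t)).state = .halt b := by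
  rw [run_toTM]
  simp only [toCfg, toTM]
  rw [h]

theorem lang_toTM : G.toTM.lang O = G.lang O := by
  ext x
  constructor
  · rintro ⟨r, n, h⟩
    exact ⟨_, _, G.action_toTM_halt h⟩
  · rintro ⟨r, t, h⟩
    exact ⟨fun n => r (n / 2), 2 * t, G.toTM_action_of_halt (by simpa using h)⟩

variable {G}

theorem PolyTime.toTM (h : G.PolyTime) : G.toTM.PolyTime := by
  obtain ⟨p, h⟩ := h
  refine ⟨2 * p, fun O r x => ?_⟩
  obtain ⟨t, ht, a, h⟩ := h O (fun t => r (2 * t)) x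
  exact ⟨2 * t, by simpa using ht, a, G.toTM_action_of_halt h⟩

theorem Deterministic.toTM (h : G.Deterministic) : G.toTM.Deterministic := by
  rintro ⟨q, _ | w⟩ δ hδ
  · rcases h' : G.action q with a | ⟨i, n⟩ | δ' <;> simp only [StackOracleMachine.toTM, h'] at hδ
    · cases hδ
    · cases hδ
    · cases hδ
      simp only [h q δ' h']
      rfl
  · simp only [StackOracleMachine.toTM] at hδ
    cases hδ
    rfl

end StackOracleMachine

/-! ### Machines for P, relativized NP and ordered queries -/

/-- The sets whose characteristic function is computable in polynomial time. -/
def DP : Set (Set (List Bool)) :=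
  {L | ∃ f, FP f ∧ ∀ x, (x ∈ L ↔ (f x).head? = some true)}

/-- Run a stack machine, then accept if the top symbol of the stack `none` is `true`. -/
def StackMachine.decider {W : Type} [Fintype W] (m : StackMachine (Option W)) :
    StackOracleMachine Empty where
  Q := m.Q ⊕ Option Bool
  W := W
  start := .inl m.start
  action
    | .inl q => .move fun _ t => ((m.step q t).1.elim (.inr none) .inl, (m.step q t).2)
    | .inr none => .move fun _ t => (.inr (some (t none == some true)), fun v => Out.keep (t v))
    | .inr (some b) => .halt b

theorem DP_subset_P : DP ⊆ P := by
  rintro L ⟨f, ⟨W, _, m, p, hm⟩, hL⟩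
  have key : ∀ x, ∃ n ≤ p.eval x.length, ∀ O r,
      m.decider.action (m.decider.run O r x (n + 1)).1 = .halt ((f x).head? == some true) := by
    intro x
    obtain ⟨n, hn, H⟩ := StackOracleMachine.exists_runFrom_of_embed (G := m.decider) (m := m)
      Sum.inl (.inr none) (fun _ => rfl) (hm x)
    refine ⟨n, hn, fun O r => ?_⟩
    have h1 : m.decider.run O r x n = _ := H O r
    rw [StackOracleMachine.run, StackOracleMachine.runFrom]
    change m.decider.action (m.decider.next O (r n) (m.decider.run O r x n)).1 = _
    rw [h1]
    simp [StackOracleMachine.next, decider, tops, io]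
  have hd : m.decider.Deterministic := by
    rintro (q | _ | b) δ hδ <;> simp only [decider] at hδ <;> cases hδ <;> rfl
  refine ⟨m.decider.toTM, hd.toTM, StackOracleMachine.PolyTime.toTM ⟨p + 1, fun O r x => ?_⟩, ?_⟩
  · obtain ⟨n, hn, H⟩ := key x
    exact ⟨n + 1, by simpa using hn, _, H O r⟩
  · rw [StackOracleMachine.lang_toTM]
    ext x
    obtain ⟨n, hn, H⟩ := key x
    rw [hL]
    constructor
    · intro h
      refine ⟨fun _ => false, n + 1, ?_⟩
      rw [H, h]
      rfl
    · rintro ⟨r, t, h⟩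
      simpa using (StackOracleMachine.halt_unique (H _ r) h)

/-- Run `A`; then, for each symbol on the stack `none`, push a guessed bit, preceded by `true`, on
the second stack; then run `B`, and accept if the oracle does not contain the result. -/
@[reducible] def guesser {W : Type} [Fintype W] (A B : StackMachine (Option (W ⊕ Bool))) :
    StackOracleMachine Unit where
  Q := (A.Q ⊕ B.Q) ⊕ Bool ⊕ Option Bool
  W := W ⊕ Bool
  start := .inl (.inl A.start)
  action
    | .inl (.inl q) => .move fun _ t =>
        ((A.step q t).1.elim (.inr (.inl false)) fun q => .inl (.inl q), (A.step q t).2)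
    | .inl (.inr q) => .move fun _ t =>
        ((B.step q t).1.elim (.inr (.inr none)) fun q => .inl (.inr q), (B.step q t).2)
    | .inr (.inl false) => .move fun b t =>
        if (t none).isSome then (.inr (.inl true), fun v => match v with
          | none => none
          | some (.inr false) => Out.push b (t v)
          | v => Out.keep (t v))
        else (.inl (.inr B.start), fun v => Out.keep (t v))
    | .inr (.inl true) => .move fun _ t => (.inr (.inl false), fun v => match v with
          | some (.inr false) => Out.push true (t v)
          | v => Out.keep (t v))
    | .inr (.inr none) => .query () fun b => .inr (.inr (some (!b)))
    | .inr (.inr (some b)) => .halt b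

/-- A round takes two steps and only the choice in the first one matters, so the guess consists of
the choices at even times, in reverse order because it is pushed bit by bit. The extra step leaves
the loop. -/
theorem guesser_loop {W : Type} [Fintype W] (A B : StackMachine (Option (W ⊕ Bool)))
    (O : Unit → Set (List Bool)) (x u v : List Bool) (r : ℕ → Bool) :
    (guesser A B).runFrom O r (.inr (.inl false), regs u (pair v x) []) (2 * u.length + 1) =
      (.inl (.inr B.start),
        regs [] (pair (((List.range u.length).map fun i => r (2 * i)).reverse ++ v) x) []) := by
  induction u generalizing v r with
  | nil =>
    exact Prod.ext rfl (applyOut_keep (regs [] (pair v x) [] : Option (W ⊕ Bool) → List Bool))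
  | cons a u ih =>
    rw [List.length_cons, show 2 * (u.length + 1) + 1 = 2 + (2 * u.length + 1) by ring,
      StackOracleMachine.runFrom_add, List.range_succ_eq_map, List.map_cons, List.reverse_cons,
      List.append_assoc, List.singleton_append]
    have h2 : (guesser A B).runFrom O r (.inr (.inl false), regs (a :: u) (pair v x) []) 2 =
        (.inr (.inl false), regs u (pair (r 0 :: v) x) []) := by
      have h1 : (guesser A B).runFrom O r (.inr (.inl false), regs (a :: u) (pair v x) []) 1 =
          (.inr (.inl true), regs u (r 0 :: pair v x) []) := by
        simp only [StackOracleMachine.runFrom, StackOracleMachine.next, guesser, tops, regs]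
        refine Prod.ext rfl (funext ?_)
        rintro (_ | _ | _ | _) <;> simp [applyOut, regs, Out.bits_push]
      rw [StackOracleMachine.runFrom, h1]
      simp only [StackOracleMachine.next, guesser, tops]
      refine Prod.ext rfl (funext ?_)
      rintro (_ | _ | _ | _) <;> simp [applyOut, regs, Out.bits_keep, pair]
    rw [h2, ih, List.map_map]
    simp only [Function.comp_def, Nat.succ_eq_add_one, Nat.mul_add, Nat.add_comm 2]

/-- The length of `f x` prescribes the length of the guess, so that no choice decides when guessing
stops and the time is polynomial on every path. The matrix occurs negated, to match `QS`. -/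
theorem mem_NPRel_of_forall {L R : Set (List Bool)} {𝒞 : Set (Set (List Bool))} (hR : R ∈ 𝒞)
    {f : List Bool → List Bool} (hf : FP f)
    (h : ∀ x, x ∈ L ↔ ∃ g : List Bool, g.length = (f x).length ∧ pair g x ∉ R) :
    L ∈ NPRel 𝒞 := by
  classical
  obtain ⟨q, hq⟩ := hf.exists_length_le
  obtain ⟨W, _, m, p, hm⟩ := hf
  let b : Option (W ⊕ Bool) := some (.inr false)
  let c : Option (W ⊕ Bool) := some (.inr true)
  let A : StackMachine (Option (W ⊕ Bool)) :=
    (((drain none fun v => decide (v = c)).seq (drain c fun v => decide (v = none ∨ v = b))).seq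
      (m.lift (Option.map .inl))).seq
      (op fun t v => if v = b then Out.push false (t v) else Out.keep (t v))
  let B : StackMachine (Option (W ⊕ Bool)) :=
    (drain b fun v => decide (v = c)).seq (drain c fun v => decide (v = none))
  have hA (x) : A.Exec (2 * x.length + 1 + (2 * x.length + 1) + p.eval x.length + 1) (io x)
      (regs (f x) (pair [] x) []) := by
    rw [io_eq_regs]
    refine Exec.mono (((Exec.seq (s' := regs [] [] x.reverse) (drain_exec ?_ ?_)
      (drain_exec (s' := regs x x []) ?_ ?_)).seq
      ((hm x).lift (s₂' := regs (f x) x []) (Option.map_injective Sum.inl_injective) ?_ ?_ ?_)).seq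
      (op_exec' ?_)) ?_
    · rfl
    · rintro (_ | _ | _ | _) <;> simp [regs, c]
    · rfl
    · rintro (_ | _ | _ | _) <;> simp [regs, c, b]
    · rintro (_ | _) <;> rfl
    · rintro (_ | _) <;> rfl
    · rintro (_ | _ | _ | _) h
      · exact absurd rfl (h none)
      · rfl
      · rfl
      · rfl
    · rintro (_ | _ | _ | _) <;> simp [regs, tops, b, Out.bits_push, Out.bits_keep, pair]
    · simp [regs, c]
  have hB (w) : B.Exec (2 * w.length + 1 + (2 * w.length + 1)) (regs [] w []) (regs w [] []) := by
    refine Exec.mono (Exec.seq (s' := regs [] [] w.reverse) (drain_exec ?_ ?_)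
      (drain_exec (s' := regs w [] []) ?_ ?_)) ?_
    · rfl
    · rintro (_ | _ | _ | _) <;> simp [regs, c, b]
    · rfl
    · rintro (_ | _ | _ | _) <;> simp [regs, c]
    · simp [regs, b, c]
  -- Here `n` is the time at which guessing starts; it depends neither on the oracle nor on the
  -- choices.
  obtain ⟨N, key⟩ : ∃ N : Polynomial ℕ, ∀ x, ∃ n, ∀ O r, ∃ t ≤ N.eval x.length,
      (guesser A B).action ((guesser A B).run O r x t).1 = .halt (!decide (pair
        ((List.range (f x).length).map fun i => r (n + 2 * i)).reverse x ∈ O ())) := by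
    refine ⟨2 * .X + 1 + (2 * .X + 1) + p + 1 + (2 * q + 1) +
      (2 * (2 * q + 1 + .X) + 1 + (2 * (2 * q + 1 + .X) + 1)) + 1, ?_⟩
    intro x
    obtain ⟨n, hn, H⟩ := StackOracleMachine.exists_runFrom_of_embed (G := guesser A B) (m := A)
      (fun q => .inl (.inl q)) (.inr (.inl false)) (fun _ => rfl) (hA x)
    refine ⟨n, fun O r => ?_⟩
    set g := ((List.range (f x).length).map fun i => r (n + 2 * i)).reverse with hg
    obtain ⟨n', hn', H'⟩ := StackOracleMachine.exists_runFrom_of_embed (G := guesser A B) (m := B)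
      (fun q => .inl (.inr q)) (.inr (.inr none)) (fun _ => rfl) (hB (pair g x))
    have h3 : (guesser A B).run O r x (n + (2 * (f x).length + 1) + n') =
        (.inr (.inr none), regs (pair g x) [] []) := by
      rw [StackOracleMachine.run, StackOracleMachine.runFrom_add, StackOracleMachine.runFrom_add]
      have := H O r
      rw [show ((guesser A B).start, io x) = ((.inl (.inl A.start), io x) :
        (guesser A B).Cfg) from rfl, this, guesser_loop, List.append_nil]
      exact H' _ _
    refine ⟨n + (2 * (f x).length + 1) + n' + 1, ?_, ?_⟩
    · have hx := hq x
      have hgl : g.length = (f x).length := by simp [hg]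
      simp only [length_pair, hgl] at hn'
      simp
      omega
    · rw [StackOracleMachine.run, StackOracleMachine.runFrom]
      rw [StackOracleMachine.run] at h3
      rw [h3]
      simp [StackOracleMachine.next, guesser, regs]
      exact decide_eq_decide.2 Iff.rfl
  refine ⟨R, hR, (guesser A B).toTM, StackOracleMachine.PolyTime.toTM ⟨N, fun O r x => ?_⟩, ?_⟩
  · obtain ⟨n, H⟩ := key x
    obtain ⟨t, ht, H⟩ := H O r
    exact ⟨t, ht, _, H⟩
  · rw [StackOracleMachine.lang_toTM]
    ext x
    obtain ⟨n, H⟩ := key x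
    rw [h]
    constructor
    · rintro ⟨g, hg, hgR⟩
      -- The guess is reversed, and its bit number `i` is the choice at time `n + 2 * i`; these
      -- choices therefore produce `g`.
      obtain ⟨t, ht, H⟩ := H (fun _ => R) (fun t => g.reverse.getD ((t - n) / 2) false)
      refine ⟨_, t, H.trans ?_⟩
      have : (List.range (f x).length).map (fun i => g.reverse.getD ((n + 2 * i - n) / 2) false) =
          g.reverse := by
        refine List.ext_getElem (by simp [hg]) fun i h1 h2 => ?_
        simp only [List.length_reverse] at h2
        simp [h2]
      rw [this, List.reverse_reverse]
      simp [hgR]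
    · rintro ⟨r, t, h'⟩
      obtain ⟨t', ht', H⟩ := H (fun _ => R) r
      have := StackOracleMachine.halt_unique H h'
      refine ⟨_, ?_, by simpa using this⟩
      simp

/-- Query the first oracle, then the second one, about the input, and accept if the answers
differ. -/
def xorMachine : StackOracleMachine Bool where
  Q := Unit ⊕ Bool ⊕ Bool
  W := Empty
  start := .inl ()
  action
    | .inl _ => .query false fun b => .inr (.inl b)
    | .inr (.inl b) => .query true fun b' => .inr (.inr (b ^^ b'))
    | .inr (.inr b) => .halt b

theorem xor_mem_POrdered {C D : Set (List Bool)} {𝒞 𝒟 : Set (Set (List Bool))} (hC : C ∈ 𝒞)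
    (hD : D ∈ 𝒟) : {x | ¬ (x ∈ C ↔ x ∈ D)} ∈ POrdered 𝒞 𝒟 := by
  classical
  have run1 (O) (r : ℕ → Bool) (x : List Bool) :
      xorMachine.run O r x 1 = (.inr (.inl (decide (x ∈ O false))), io x) := by
    simp [StackOracleMachine.run, StackOracleMachine.runFrom, StackOracleMachine.next, xorMachine,
      io]
    exact decide_eq_decide.2 Iff.rfl
  have run2 (O) (r : ℕ → Bool) (x : List Bool) :
      xorMachine.run O r x 2 =
        (.inr (.inr (decide (x ∈ O false) ^^ decide (x ∈ O true))), io x) := by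
    have := run1 O r x
    rw [StackOracleMachine.run] at this ⊢
    rw [StackOracleMachine.runFrom, this]
    simp [StackOracleMachine.next, xorMachine, io]
    exact decide_eq_decide.2 Iff.rfl
  have halt2 (O) (r : ℕ → Bool) (x : List Bool) :
      xorMachine.action (xorMachine.run O r x 2).1 =
        .halt (decide (x ∈ O false) ^^ decide (x ∈ O true)) := by
    rw [run2]; rfl
  have hd : xorMachine.Deterministic := by
    rintro (q | _ | b) δ hδ <;> simp only [xorMachine] at hδ <;> cases hδ
  -- The stack machine queries in its steps 0 and 1, which are steps 0 and 2 of the Turing machine.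
  have hq (O) (r : ℕ → Bool) (x : List Bool) (n : ℕ) (i : Bool)
      (hn : xorMachine.toTM.QueriesAt O r x n i) : n = bif i then 2 else 0 := by
    obtain ⟨t, q, rfl, h⟩ := xorMachine.action_toTM_query hn
    clear hn
    rcases t with _ | _ | t
    · simp only [StackOracleMachine.run, StackOracleMachine.runFrom, xorMachine] at h
      cases h
      rfl
    · rw [run1] at h
      simp only [xorMachine] at h
      cases h
      rfl
    · have := StackOracleMachine.runFrom_eq_of_halt_of_le (halt2 O (fun t => r (2 * t)) x)
        (show 2 ≤ t + 1 + 1 by omega)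
      rw [StackOracleMachine.run, this] at h
      have h2 := halt2 O (fun t => r (2 * t)) x
      rw [StackOracleMachine.run, h] at h2
      cases h2
  refine ⟨C, hC, D, hD, xorMachine.toTM, hd.toTM, StackOracleMachine.PolyTime.toTM
    ⟨2, fun O r x => ⟨2, by simp, _, halt2 O r x⟩⟩, fun r x => ⟨fun i s t hs ht => ?_,
    fun s t hs ht => ?_⟩, ?_⟩
  · rw [hq _ _ _ _ _ hs, hq _ _ _ _ _ ht]
  · rw [hq _ _ _ _ _ hs, hq _ _ _ _ _ ht]
    simp
  · rw [StackOracleMachine.lang_toTM]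
    ext x
    constructor
    · intro h
      refine ⟨fun _ => false, 2, ?_⟩
      rw [halt2]
      by_cases h1 : x ∈ C <;> by_cases h2 : x ∈ D <;> simp_all
    · rintro ⟨r, t, h⟩
      have := StackOracleMachine.halt_unique (halt2 _ r x) h
      by_cases h1 : x ∈ C <;> by_cases h2 : x ∈ D <;> simp_all

/-! ### Turing machines simulated by stack machines -/

namespace OracleTM

variable {ι : Type} (M : OracleTM ι)

/-- One step in which the bit `b` is the nondeterministic choice or the answer to the query. -/
def bitNext (b : Bool) (c : M.Cfg) : M.Cfg :=
  match M.action c.state with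
  | .halt _ => c
  | .query _ q => ⟨q b, c.tape⟩
  | .move δ =>
    let d := δ b fun k => (c.tape k).head
    ⟨d.1, fun k => StackOracleMachine.moveOpt (d.2 k).2 ((c.tape k).write (d.2 k).1)⟩

/-- The configuration reached on input `x` when the choices and answers are the bits of `r`. -/
def bitRun (x r : List Bool) : M.Cfg :=
  r.foldl (fun c b => M.bitNext b c) (M.init x)

/-- For a pair of an input and a word of bits: a bit depending on the state reached, followed by the
word on the query tape. -/
def status (κ : M.Q → Bool) (z : List Bool) : List Bool :=
  let c := M.bitRun (unpair z).1 (unpair z).2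
  κ c.state :: tapeWord (c.tape M.queryTape)

/-- At most two cells that replace the first one of a list. -/
abbrev CellOut : Type := Option (Cell M.A × Option (Cell M.A))

/-- The cells in `o`. -/
def CellOut.cells : M.CellOut → List (Cell M.A)
  | none => []
  | some (c, none) => [c]
  | some (c, some b) => [b, c]

open Classical in
/-- Whether `c` is `γ`. -/
noncomputable def cellEq (γ c : Cell M.A) : Bool := decide (c = γ)

/-- The stack operation, on the stack that belongs to the symbol `γ`, for an operation on cells. -/
noncomputable def CellOut.toOut (o : M.CellOut) (γ : Cell M.A) : Out :=
  o.map fun c => (cellEq M γ c.1, c.2.map (cellEq M γ))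

/-- Keep a cell. -/
def CellOut.keep (c : Option (Cell M.A)) : M.CellOut := c.map fun c => (c, none)

/-- Push `w` on top of a cell. -/
def CellOut.push (w : Cell M.A) : Option (Cell M.A) → M.CellOut
  | none => some (w, none)
  | some c => some (c, some w)

/-- The stacks for the simulation of `M`: for each half-tape and each symbol, the places of the
symbol on the half-tape; three further stacks. -/
abbrev Stacks : Type := Option ((M.K × Bool × Cell M.A) ⊕ Bool)

/-- The content of the stacks when the half-tapes contain `L` and `R`. -/
noncomputable def halfTapes (x y z : List Bool) (L R : M.K → List (Cell M.A)) :
    M.Stacks → List Bool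
  | none => x
  | some (.inr false) => y
  | some (.inr true) => z
  | some (.inl (k, false, γ)) => (L k).map (cellEq M γ)
  | some (.inl (k, true, γ)) => (R k).map (cellEq M γ)

open Classical in
/-- The symbol on top of a half-tape. -/
noncomputable def topCell (t : M.Stacks → Option Bool) (k : M.K) (d : Bool) :
    Option (Cell M.A) :=
  if h : ∃ γ, t (some (.inl (k, d, γ))) = some true then some h.choose else none

/-- Cells are coded one-hot: of the equally high stacks of a half-tape, exactly the one for the
symbol `γ` in a cell shows `true` at its place. -/
theorem topCell_eq {s : M.Stacks → List Bool} {k : M.K} {d : Bool} {l : List (Cell M.A)}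
    (h : ∀ γ, s (some (.inl (k, d, γ))) = l.map (cellEq M γ)) :
    M.topCell (tops s) k d = l.head? := by
  classical
  rcases l with _ | ⟨c, l⟩
  · simp [topCell, tops, h]
  · have h' : ∃ γ, tops s (some (.inl (k, d, γ))) = some true := ⟨c, by simp [tops, h, cellEq]⟩
    have h2 : cellEq M h'.choose c = true := by
      have := h'.choose_spec
      generalize h'.choose = γ at this
      simpa [tops, h] using this
    rw [topCell, dif_pos h', ← of_decide_eq_true h2]
    rfl

theorem CellOut.bits_toOut (o : M.CellOut) (γ : Cell M.A) (l : List (Cell M.A)) :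
    (o.toOut M γ).bits ++ (l.map (cellEq M γ)).tail =
      (o.cells M ++ l.tail).map (cellEq M γ) := by
  rcases o with _ | ⟨c, _ | b⟩ <;>
    simp [CellOut.toOut, Out.bits, CellOut.cells, List.map_tail]

/-- Given the cell on top of the left half-tape, write `w` and move the head. -/
def halfMove (w : Cell M.A) (l : Option (Cell M.A)) :
    Option Turing.Dir → Bool → M.CellOut
  | none, false => .keep M l
  | none, true => some (w, none)
  | some .left, false => none
  | some .left, true => some (w, some (l.getD none))
  | some .right, false => .push M w l
  | some .right, true => none

/-- The half-tapes `L` and `R` represent the tapes of `c`. -/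
def Represents (c : M.Cfg) (L R : M.K → List (Cell M.A)) : Prop :=
  ∀ k, c.tape k = Turing.Tape.mk' (Turing.ListBlank.mk (L k)) (Turing.ListBlank.mk (R k))

/-- The scanned cell is the first one of the right half-tape, so a step replaces at most the first
cell of each half, and the left half matters only through its first cell. -/
theorem moveOpt_write_mk' (w : Cell M.A) (d : Option Turing.Dir) (L R : List (Cell M.A)) :
    StackOracleMachine.moveOpt d
      ((Turing.Tape.mk' (Turing.ListBlank.mk L) (Turing.ListBlank.mk R)).write w) =
    Turing.Tape.mk'
      (Turing.ListBlank.mk ((M.halfMove w L.head? d false).cells M ++ L.tail))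
      (Turing.ListBlank.mk ((M.halfMove w L.head? d true).cells M ++ R.tail)) := by
  rcases d with _ | _ | _ <;> rcases L with _ | ⟨l, L⟩ <;> rcases R with _ | ⟨r, R⟩ <;>
    simp [StackOracleMachine.moveOpt, halfMove, CellOut.cells, CellOut.keep, CellOut.push,
      Turing.Tape.mk', Turing.Tape.write, Turing.Tape.move] <;> rfl

theorem head_mk' (L R : List (Cell M.A)) :
    (Turing.Tape.mk' (Turing.ListBlank.mk L) (Turing.ListBlank.mk R)).head =
      R.head?.getD none := by
  cases R <;> rfl

/-- Simulates `M`, using the bits on the stack `none` as choices and answers. Finally, the bit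
given by `κ` is pushed on the last stack. -/
@[reducible] noncomputable def simulator (κ : M.Q → Bool) : StackMachine M.Stacks where
  Q := M.Q
  start := M.start
  step q t := match t none with
    | none => (none, fun v => match v with
      | some (.inr true) => Out.push (κ q) (t v)
      | v => Out.keep (t v))
    | some b => match M.action q with
      | .halt _ => (some q, fun v => match v with
        | none => none
        | v => Out.keep (t v))
      | .query _ n => (some (n b), fun v => match v with
        | none => none
        | v => Out.keep (t v))
      | .move δ =>
        let d := δ b fun k => (M.topCell t k true).getD none
        (some d.1, fun v => match v with
          | none => none
          | some (.inl (k, e, γ)) => (M.halfMove (d.2 k).1 (M.topCell t k false)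
              (d.2 k).2 e).toOut M γ
          | v => Out.keep (t v))

/-- The stack machine sees all tops at once, so it needs one step for each step of `M`; the
additional step records `κ`. -/
theorem simulator_iterate (κ : M.Q → Bool) (r y z : List Bool) (c : M.Cfg)
    (L R : M.K → List (Cell M.A)) (h : M.Represents c L R) :
    ∃ L' R', M.Represents (r.foldl (fun c b => M.bitNext b c) c) L' R' ∧
      (M.simulator κ).next^[r.length + 1] (some c.state, M.halfTapes r y z L R) =
      (none, M.halfTapes [] y (κ (r.foldl (fun c b => M.bitNext b c) c).state :: z) L' R') := by
  induction r generalizing c L R with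
  | nil =>
    refine ⟨L, R, h, ?_⟩
    simp only [List.length_nil, zero_add, Function.iterate_one, StackMachine.next, simulator, tops,
      halfTapes, List.head?_nil, List.foldl_nil]
    refine Prod.ext rfl (funext ?_)
    rintro (_ | ⟨k, _ | _, γ⟩ | _ | _) <;>
      simp [applyOut, halfTapes, Out.bits_push, Out.bits_keep, -List.head?_map]
  | cons b r ih =>
    obtain ⟨L₁, R₁, h₁, e⟩ : ∃ L' R', M.Represents (M.bitNext b c) L' R' ∧
        (M.simulator κ).next (some c.state, M.halfTapes (b :: r) y z L R) =
        (some (M.bitNext b c).state, M.halfTapes r y z L' R') := by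
      rcases hc : M.action c.state with a | ⟨i, n⟩ | δ
      · refine ⟨L, R, by simp only [bitNext, hc]; exact h, ?_⟩
        simp only [StackMachine.next, simulator, tops, halfTapes, bitNext, hc, List.head?_cons]
        refine Prod.ext rfl (funext ?_)
        rintro (_ | ⟨k, _ | _, γ⟩ | _ | _) <;>
          simp [applyOut, halfTapes, Out.bits_keep, -List.head?_map]
      · refine ⟨L, R, by simp only [bitNext, hc]; exact h, ?_⟩
        simp only [StackMachine.next, simulator, tops, halfTapes, bitNext, hc, List.head?_cons]
        refine Prod.ext rfl (funext ?_)
        rintro (_ | ⟨k, _ | _, γ⟩ | _ | _) <;>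
          simp [applyOut, halfTapes, Out.bits_keep, -List.head?_map]
      · have hL (k) : M.topCell (tops (M.halfTapes (b :: r) y z L R)) k false = (L k).head? :=
          M.topCell_eq (l := L k) fun γ => rfl
        have hR (k) : M.topCell (tops (M.halfTapes (b :: r) y z L R)) k true = (R k).head? :=
          M.topCell_eq (l := R k) fun γ => rfl
        let d := δ b fun k => (R k).head?.getD none
        have hd : (δ b fun k => (c.tape k).head) = d := by
          simp only [d, h _, head_mk']
        refine ⟨fun k => (M.halfMove (d.2 k).1 (L k).head? (d.2 k).2 false).cells M ++
          (L k).tail, fun k => (M.halfMove (d.2 k).1 (L k).head? (d.2 k).2 true).cells M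
          ++ (R k).tail, fun k => ?_, ?_⟩
        · simp only [bitNext, hc, hd]
          rw [h k, moveOpt_write_mk']
        · simp only [bitNext, hc, hd, StackMachine.next, simulator, hL, hR]
          simp only [tops, halfTapes, List.head?_cons]
          refine Prod.ext rfl (funext ?_)
          rintro (_ | ⟨k, _ | _, γ⟩ | _ | _)
          · simp [applyOut, halfTapes]
          · exact CellOut.bits_toOut M _ γ (L k)
          · exact CellOut.bits_toOut M _ γ (R k)
          · exact Out.bits_keep _
          · exact Out.bits_keep _
    obtain ⟨L', R', h', e'⟩ := ih (M.bitNext b c) L₁ R₁ h₁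
    refine ⟨L', R', h', ?_⟩
    rw [List.length_cons, Function.iterate_succ_apply, e, e']
    rfl

open Classical in
/-- Move the word on the second stack, reversed, to the input tape. -/
noncomputable def loader : StackMachine M.Stacks :=
  loop (fun t => (t (some (.inr false))).isSome) (op fun t v => match v with
    | some (.inr false) => none
    | some (.inl (k, true, γ)) => if k = M.inputTape then
        Out.push (M.cellEq γ ((t (some (.inr false))).map .inl)) (t v) else Out.keep (t v)
    | v => Out.keep (t v))

theorem loader_exec (x y z : List Bool) (L R : M.K → List (Cell M.A)) :
    M.loader.Exec (2 * y.length + 1) (M.halfTapes x y z L R) (M.halfTapes x [] z L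
      (Function.update R M.inputTape
        ((y.reverse.map fun b => some (.inl b)) ++ R M.inputTape))) := by
  induction y generalizing R with
  | nil =>
    simp only [List.reverse_nil, List.map_nil, List.nil_append, Function.update_eq_self]
    exact (loop_exec_false (by simp [tops, halfTapes])).mono (by simp)
  | cons b y ih =>
    have := ih (Function.update R M.inputTape (some (.inl b) :: R M.inputTape))
    simp only [Function.update_self, Function.update_idem] at this
    simp only [List.reverse_cons, List.map_append, List.map_cons, List.map_nil, List.append_assoc,
      List.singleton_append]
    refine (loop_exec_true (by simp [tops, halfTapes]) (op_exec' ?_) this).mono (by simp; omega)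
    rintro (_ | ⟨k, _ | _, γ⟩ | _ | _)
    · exact (Out.bits_keep _).symm
    · exact (Out.bits_keep _).symm
    · by_cases hk : k = M.inputTape
      · subst hk
        simp [tops, halfTapes, Out.bits_push, -List.head?_map]
      · simp [tops, halfTapes, Out.bits_keep, hk, -List.head?_map]
    · simp [halfTapes]
    · exact (Out.bits_keep _).symm

/-- Move the word on the query tape, reversed, to the second stack. -/
noncomputable def reader : StackMachine M.Stacks :=
  loop (fun t => match M.topCell t M.queryTape true with
    | some (some (.inl _)) => true
    | _ => false) (op fun t v => match v with
    | some (.inr false) => match M.topCell t M.queryTape true with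
      | some (some (.inl b)) => Out.push b (t v)
      | _ => Out.keep (t v)
    | some (.inl (k, true, _)) => if k = M.queryTape then none else Out.keep (t v)
    | v => Out.keep (t v))

/-- Reading destroys the query tape. Of what is left only the lengths matter, since everything is
erased afterwards. -/
theorem reader_exec (x y z : List Bool) (L R : M.K → List (Cell M.A)) :
    ∃ R', (∀ k, (R' k).length ≤ (R k).length) ∧
      M.reader.Exec (2 * (R M.queryTape).length + 1) (M.halfTapes x y z L R)
        (M.halfTapes x ((readBits (R M.queryTape)).reverse ++ y) z L R') := by
  induction hl : R M.queryTape generalizing R y with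
  | nil =>
    refine ⟨R, fun _ => le_rfl, (loop_exec_false ?_).mono (by simp)⟩
    rw [M.topCell_eq (l := R M.queryTape) fun γ => rfl, hl]
    rfl
  | cons c l ih =>
    have ht : M.topCell (tops (M.halfTapes x y z L R)) M.queryTape true = some c := by
      rw [M.topCell_eq (l := R M.queryTape) fun γ => rfl, hl]
      rfl
    rcases c with _ | b | a
    · exact ⟨R, fun _ => le_rfl, (loop_exec_false (by rw [ht])).mono (by simp)⟩
    · obtain ⟨R', hR', h⟩ := ih (b :: y) (Function.update R M.queryTape l) (by simp)
      refine ⟨R', fun k => (hR' k).trans ?_, ?_⟩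
      · by_cases hk : k = M.queryTape
        · subst hk; simp [hl]
        · simp [hk]
      · simp only [readBits, List.reverse_cons, List.append_assoc, List.singleton_append]
        refine (loop_exec_true (by rw [ht]) (op_exec' ?_) h).mono (by simp; omega)
        rintro (_ | ⟨k, _ | _, γ⟩ | _ | _)
        · exact (Out.bits_keep _).symm
        · exact (Out.bits_keep _).symm
        · by_cases hk : k = M.queryTape
          · subst hk
            simp [halfTapes, hl]
          · simp [tops, halfTapes, Out.bits_keep, hk, -List.head?_map]
        · simp [ht, tops, halfTapes, Out.bits_push]
        · exact (Out.bits_keep _).symm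
    · exact ⟨R, fun _ => le_rfl, (loop_exec_false (by rw [ht])).mono (by simp)⟩

open Classical in
/-- Erase the tapes. -/
noncomputable def eraser : StackMachine M.Stacks :=
  loop (fun t => decide (∃ w, (t (some (.inl w))).isSome)) (op fun t v => match v with
    | some (.inl _) => none
    | v => Out.keep (t v))

theorem eraser_exec (x y z : List Bool) (L R : M.K → List (Cell M.A)) (N : ℕ)
    (hL : ∀ k, (L k).length ≤ N) (hR : ∀ k, (R k).length ≤ N) :
    M.eraser.Exec (2 * N + 1) (M.halfTapes x y z L R)
      (M.halfTapes x y z (fun _ => []) fun _ => []) := by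
  induction N generalizing L R with
  | zero =>
    obtain rfl : L = fun _ => [] := funext fun k => List.eq_nil_of_length_eq_zero (by simpa using hL k)
    obtain rfl : R = fun _ => [] := funext fun k => List.eq_nil_of_length_eq_zero (by simpa using hR k)
    refine loop_exec_false ?_
    simp only [decide_eq_false_iff_not, not_exists]
    rintro ⟨k, _ | _, γ⟩ <;> simp [tops, halfTapes]
  | succ N ih =>
    have h := ih (fun k => (L k).tail) (fun k => (R k).tail)
      (fun k => by have := hL k; simp; omega) (fun k => by have := hR k; simp; omega)
    by_cases hc : ∃ w, (tops (M.halfTapes x y z L R) (some (.inl w))).isSome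
    · refine (loop_exec_true (by simpa using hc) (op_exec' ?_) h).mono (by omega)
      rintro (_ | ⟨k, _ | _, γ⟩ | _ | _)
      · exact (Out.bits_keep _).symm
      · simp [halfTapes, List.map_tail]
      · simp [halfTapes, List.map_tail]
      · exact (Out.bits_keep _).symm
      · exact (Out.bits_keep _).symm
    · have hnil : M.halfTapes x y z L R = M.halfTapes x y z (fun _ => []) fun _ => [] := by
        funext v
        rcases v with _ | ⟨k, _ | _, γ⟩ | _ | _
        · rfl
        · by_contra hne
          exact hc ⟨(k, false, γ), by rcases hk : L k <;> simp_all [tops, halfTapes]⟩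
        · by_contra hne
          exact hc ⟨(k, true, γ), by rcases hk : R k <;> simp_all [tops, halfTapes]⟩
        · rfl
        · rfl
      rw [← hnil]
      exact (loop_exec_false (by simpa using hc)).mono (by omega)

theorem represents_init (x : List Bool) :
    M.Represents (M.init x) (fun _ => []) (Function.update (fun _ => []) M.inputTape
      (x.map fun b => some (.inl b))) := by
  intro k
  by_cases hk : k = M.inputTape
  · subst hk
    simp only [init, if_true, Function.update_self]
    rfl
  · simp only [init, hk, if_false, Function.update_of_ne, ne_eq, not_false_eq_true]
    rfl

/-- With choices and answers supplied as bits, following `M` needs no oracle. Acceptance, being in a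
query state, and the word asked about are all read off `status` for suitable `κ`. -/
theorem fp_status (κ : M.Q → Bool) : FP (M.status κ) := by
  classical
  let b : M.Stacks := some (.inr false)
  let c : M.Stacks := some (.inr true)
  refine ⟨(M.K × Bool × Cell M.A) ⊕ Bool, inferInstance, ((((((unpack none b).seq M.loader).seq
    (M.simulator κ)).seq M.reader).seq (drain b fun v => decide (v = none))).seq
    (drain c fun v => decide (v = none))).seq M.eraser, 300 * .X + 600, fun z => ?_⟩
  have hlen := length_unpair z
  have hio (x) : (io x : M.Stacks → List Bool) =
      M.halfTapes x [] [] (fun _ => []) fun _ => [] := by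
    funext v
    rcases v with _ | ⟨k, _ | _, γ⟩ | _ | _ <;> rfl
  obtain ⟨L, R, hLR, hsim⟩ := M.simulator_iterate κ (unpair z).2 [] [] (M.init (unpair z).1) _ _
    (M.represents_init (unpair z).1)
  have hload := M.loader_exec (unpair z).2 (unpair z).1.reverse [] (fun _ => []) fun _ => []
  rw [List.reverse_reverse, List.append_nil] at hload
  have hsim' : (M.simulator κ).Exec ((unpair z).2.length + 1) _ _ := ⟨_, le_rfl, hsim⟩
  have h₃ := ((unpack_exec (s := M.halfTapes z [] [] (fun _ => []) fun _ => [])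
    (s' := M.halfTapes (unpair z).2 (unpair z).1.reverse [] (fun _ => []) fun _ => [])
    (a := none) (c := b) (by simp [b]) ?_ ?_ ?_).seq hload).seq hsim'
  -- The half-tapes are no longer than the time spent so far allows. Any symbol serves in place of
  -- `none`, as all stacks of a half-tape have the same height.
  · have hlenL (k) := h₃.length_le (some (.inl (k, false, none)))
    have hlenR (k) := h₃.length_le (some (.inl (k, true, none)))
    simp only [halfTapes, List.length_map, List.length_nil, List.length_reverse] at hlenL hlenR
    obtain ⟨R', hR', h₄⟩ := M.reader_exec []
      [] [κ (List.foldl (fun c b => M.bitNext b c) (M.init (unpair z).1) (unpair z).2).state] L R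
    have hw : tapeWord ((M.bitRun (unpair z).1 (unpair z).2).tape M.queryTape) =
        readBits (R M.queryTape) := by
      rw [bitRun, hLR M.queryTape]
      simp only [tapeWord, Turing.Tape.mk'_right₀]
      rfl
    have hwl := h₄.length_le b
    simp only [halfTapes, b, List.append_nil, List.length_reverse, List.length_nil] at hwl
    rw [hio, hio]
    refine ((((h₃.seq h₄).seq (drain_exec (s' := M.halfTapes (readBits (R M.queryTape)) []
      [κ (M.bitRun (unpair z).1 (unpair z).2).state] L R') ?_ ?_)).seq
      (drain_exec (s' := M.halfTapes (M.status κ z) [] [] L R') ?_ ?_)).seq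
      (M.eraser_exec _ _ _ _ _ (2 * (10 * z.length + 20)) ?_ ?_)).mono ?_
    · rfl
    · rintro (_ | ⟨k, _ | _, γ⟩ | _ | _) <;> simp [halfTapes, b, bitRun]
    · rfl
    · rintro (_ | ⟨k, _ | _, γ⟩ | _ | _) <;> simp [halfTapes, c, status, hw]
    · intro k
      have := hlenL k
      omega
    · intro k
      have := (hR' k).trans (hlenR k)
      omega
    · have := hlenR M.queryTape
      simp [halfTapes, b, c]
      omega
  · rfl
  · simp [halfTapes, b]
  · rintro (_ | ⟨k, _ | _, γ⟩ | _ | _) <;> simp [halfTapes, b]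

end OracleTM

/-! ### Recursion and unary arithmetic in polynomial time -/

namespace FP

variable {f g h : List Bool → List Bool}

theorem ite (hh : FP h) (hf : FP f) (hg : FP g) :
    FP fun x => if (h x).head? = some true then f x else g x := by
  -- The test is reduced to one bit `b` because `pair [b] x` is `true :: b :: false :: x`: one
  -- `tail` exposes `b`, two more give `x`.
  have h1 : FP fun x => if (h x).head? = some true then [true] else [false] :=
    (ite_head (const [true]) (const [false])).comp hh
  have h2 : FP fun w => if w.head? = some true then f w.tail.tail else g w.tail.tail :=
    ite_head (hf.comp (tail.comp tail)) (hg.comp (tail.comp tail))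
  refine cast (congrArg FP (funext fun x => ?_)) (h2.comp (tail.comp (h1.pair FP.id)))
  by_cases hx : (h x).head? = some true <;> simp [hx, QueryOrder.pair]

/-- Recursion on a word, when each step increases the length by at most a polynomial in the length
of the parameter. -/
theorem foldl {xs a : List Bool → List Bool} (hxs : FP xs) (ha : FP a)
    {s : List Bool → Bool → List Bool → List Bool}
    (hs : ∀ b, FP fun z => s (unpair z).1 b (unpair z).2)
    (c : Polynomial ℕ) (hc : ∀ x b acc, (s x b acc).length ≤ acc.length + c.eval x.length) :
    FP fun x => (xs x).foldl (fun acc b => s x b acc) (a x) := by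
  obtain ⟨p, hp⟩ := hxs.exists_length_le
  obtain ⟨q, hq⟩ := ha.exists_length_le
  -- The parameter is carried along, paired with the accumulator.
  have hg : FP fun w => QueryOrder.pair (unpair w.tail).1 (if w.head? = some true then
      s (unpair w.tail).1 true (unpair w.tail).2 else s (unpair w.tail).1 false (unpair w.tail).2) :=
    (fst.comp tail).pair (ite_head ((hs true).comp tail) ((hs false).comp tail))
  have step (x : List Bool) (l : List Bool) (u : List Bool) :
      l.foldl (fun acc b => (fun w => QueryOrder.pair (unpair w.tail).1 (if w.head? = some true then
      s (unpair w.tail).1 true (unpair w.tail).2 else s (unpair w.tail).1 false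
        (unpair w.tail).2)) (b :: acc)) (QueryOrder.pair x u) =
      QueryOrder.pair x (l.foldl (fun acc b => s x b acc) u) := by
    induction l generalizing u with
    | nil => rfl
    | cons b l ih =>
      rw [List.foldl_cons, List.foldl_cons, ← ih]
      cases b <;> simp
  have len (x l u : List Bool) : (l.foldl (fun acc b => s x b acc) u).length ≤
      u.length + l.length * c.eval x.length := by
    induction l generalizing u with
    | nil => simp
    | cons b l ih =>
      refine (ih (s x b u)).trans ?_
      have := hc x b u
      rw [List.length_cons, Nat.add_mul]
      omega
  have key := hg.foldl_cons hxs (FP.id.pair ha) (2 * .X + 1 + (q + p * c)) fun x l hl => by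
    rw [step, length_pair]
    have h1 := len x l (a x)
    have h2 : l.length * c.eval x.length ≤ p.eval x.length * c.eval x.length :=
      Nat.mul_le_mul_right _ (hl.length_le.trans (hp x))
    have h3 := hq x
    simp only [Polynomial.eval_add, Polynomial.eval_mul, Polynomial.eval_X, Polynomial.eval_one,
      Polynomial.eval_ofNat]
    omega
  refine cast (congrArg FP (funext fun x => ?_)) (snd.comp key)
  rw [step, unpair_pair]

theorem replicate_append (hf : FP f) (hg : FP g) :
    FP fun x => List.replicate (f x).length true ++ g x := by
  have := foldl hf hg (s := fun _ _ acc => true :: acc) (fun _ => snd.cons true) 1 (by simp)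
  refine cast (congrArg FP (funext fun x => ?_)) this
  generalize g x = u
  induction f x generalizing u with
  | nil => rfl
  | cons b l ih =>
    rw [List.foldl_cons, ih, List.length_cons, List.replicate_succ', List.append_assoc]
    rfl

theorem replicate_mul (hf : FP f) (hg : FP g) :
    FP fun x => List.replicate ((f x).length * (g x).length) true := by
  obtain ⟨c, hc⟩ := hg.exists_length_le
  have := foldl hf (const []) (s := fun x _ acc => List.replicate (g x).length true ++ acc)
    (fun _ => (hg.comp fst).replicate_append snd) c
    (fun x b acc => by have := hc x; simp; omega)
  refine cast (congrArg FP (funext fun x => ?_)) this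
  have h2 : ∀ (l : List Bool) (n : ℕ), l.foldl
      (fun acc _ => List.replicate (g x).length true ++ acc) (List.replicate n true) =
      List.replicate (l.length * (g x).length + n) true := by
    intro l
    induction l with
    | nil => simp
    | cons b l ih =>
      intro n
      rw [List.foldl_cons, ← List.replicate_add, ih, List.length_cons]
      congr 1
      ring
  exact h2 (f x) 0

theorem replicate_eval (p : Polynomial ℕ) (hf : FP f) :
    FP fun x => List.replicate (p.eval (f x).length) true := by
  induction p using Polynomial.induction_on with
  | C a => simpa using const (List.replicate a true)
  | add p q hp hq =>
    refine cast (congrArg FP (funext fun x => ?_)) (hp.replicate_append hq)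
    rw [List.length_replicate, ← List.replicate_add, Polynomial.eval_add]
  | monomial n a ih =>
    refine cast (congrArg FP (funext fun x => ?_)) (ih.replicate_mul hf)
    simp only [Polynomial.eval_mul, Polynomial.eval_C, Polynomial.eval_pow, Polynomial.eval_X,
      pow_succ, mul_assoc, List.length_replicate]

theorem drop (hf : FP f) (hg : FP g) : FP fun x => (g x).drop (f x).length := by
  have := foldl hf hg (s := fun _ _ acc => acc.tail) (fun _ => tail.comp snd) 1
    (fun x b acc => by simp; omega)
  refine cast (congrArg FP (funext fun x => ?_)) this
  generalize g x = u
  induction f x generalizing u with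
  | nil => rfl
  | cons b l ih => simp [ih]

end FP

/-- The `n`-th word in a list of words that is coded by iterated pairing. -/
def nthWord (n : ℕ) (z : List Bool) : List Bool :=
  (unpair ((fun z => (unpair z).2)^[n] z)).1

/-- The code of a list of words. -/
def codeList : List (List Bool) → List Bool
  | [] => []
  | y :: l => pair y (codeList l)

theorem nthWord_codeList (l : List (List Bool)) (n : ℕ) (hn : n < l.length) :
    nthWord n (codeList l) = l[n] := by
  induction l generalizing n with
  | nil => simp at hn
  | cons y l ih =>
    cases n with
    | zero => simp [nthWord, codeList]
    | succ n =>
      rw [List.getElem_cons_succ, ← ih n (by simpa using hn)]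
      simp [nthWord, codeList]

theorem length_codeList_le (l : List (List Bool)) (N : ℕ) (h : ∀ y ∈ l, y.length ≤ N) :
    (codeList l).length ≤ l.length * (2 * N + 1) := by
  induction l with
  | nil => simp [codeList]
  | cons y l ih =>
    have h1 := ih fun y hy => h y (List.mem_cons_of_mem _ hy)
    have h2 := h y List.mem_cons_self
    rw [codeList, length_pair, List.length_cons, Nat.add_mul]
    omega

theorem FP.nthWord {f g : List Bool → List Bool} (hf : FP f) (hg : FP g) :
    FP fun x => nthWord (f x).length (g x) := by
  have := foldl hf hg (s := fun _ _ acc => (unpair acc).2) (fun _ => snd.comp snd) 1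
    (fun x b acc => by have := length_unpair acc; omega)
  refine cast (congrArg FP (funext fun x => ?_)) (fst.comp this)
  rw [QueryOrder.nthWord]
  generalize g x = u
  congr 1
  induction f x generalizing u with
  | nil => rfl
  | cons b l ih => simp [ih]

/-! ### Predicates decidable in polynomial time -/

namespace DP

variable {L L' : Set (List Bool)} {f g : List Bool → List Bool}

theorem of_head (hf : FP f) : {x | (f x).head? = some true} ∈ DP :=
  ⟨f, hf, fun _ => Iff.rfl⟩

theorem preimage (hL : L ∈ DP) (hf : FP f) : {x | f x ∈ L} ∈ DP := by
  obtain ⟨u, hu, hL⟩ := hL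
  exact ⟨_, hu.comp hf, fun x => hL (f x)⟩

theorem compl (hL : L ∈ DP) : Lᶜ ∈ DP := by
  obtain ⟨u, hu, hL⟩ := hL
  refine ⟨_, hu.ite (.const [false]) (.const [true]), fun x => ?_⟩
  rw [Set.mem_compl_iff, hL]
  by_cases h : (u x).head? = some true <;> simp [h]

theorem inter (hL : L ∈ DP) (hL' : L' ∈ DP) : L ∩ L' ∈ DP := by
  obtain ⟨u, hu, hL⟩ := hL
  obtain ⟨u', hu', hL'⟩ := hL'
  refine ⟨_, hu.ite hu' (.const [false]), fun x => ?_⟩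
  rw [Set.mem_inter_iff, hL, hL']
  by_cases h : (u x).head? = some true <;> simp [h]

theorem union (hL : L ∈ DP) (hL' : L' ∈ DP) : L ∪ L' ∈ DP := by
  rw [← compl_compl (L ∪ L'), Set.compl_union]
  exact compl (inter (compl hL) (compl hL'))

theorem const (p : Prop) : {_x : List Bool | p} ∈ DP := by
  by_cases hp : p
  · exact ⟨_, .const [true], by simp [hp]⟩
  · exact ⟨_, .const [], by simp [hp]⟩

theorem length_le (hf : FP f) (hg : FP g) : {x | (f x).length ≤ (g x).length} ∈ DP := by
  refine ⟨_, hf.drop ((hg.replicate_append (.const [])).cons true), fun x => ?_⟩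
  simp only [List.append_nil, Set.mem_ofPred_eq, ← List.replicate_succ, List.drop_replicate]
  rw [List.head?_replicate]
  split_ifs <;> simp <;> omega

/-- The accumulator is `true` followed by the counter in unary while all tests have succeeded, and
the empty word after a failure. -/
theorem forall_lt (hL : L ∈ DP) (hf : FP f) :
    {x | ∀ t < (f x).length, pair x (List.replicate t true) ∈ L} ∈ DP := by
  classical
  obtain ⟨u, hu, hL⟩ := hL
  let s : List Bool → Bool → List Bool → List Bool := fun x _ acc =>
    if acc.head? = some true then
      if (u (pair x acc.tail)).head? = some true then true :: acc else []
    else []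
  have hs : FP fun z => s (unpair z).1 true (unpair z).2 :=
    FP.snd.ite ((hu.comp (FP.fst.pair (FP.tail.comp FP.snd))).ite (FP.snd.cons true)
      (.const [])) (.const [])
  refine ⟨_, FP.foldl hf (.const [true]) (s := s) (fun _ => hs) 1 (fun x b acc => ?_), fun x => ?_⟩
  · simp only [s]
    split_ifs <;> simp
  · have key : ∀ l : List Bool, l.foldl (fun acc b => s x b acc) [true] =
        if ∀ t < l.length, pair x (List.replicate t true) ∈ L then
          List.replicate (l.length + 1) true else [] := by
      intro l
      induction l using List.reverseRecOn with
      | nil => simp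
      | append_singleton l b ih =>
        rw [List.foldl_append, ih, List.foldl_cons, List.foldl_nil]
        by_cases h : ∀ t < l.length, pair x (List.replicate t true) ∈ L
        · rw [if_pos h]
          by_cases h' : pair x (List.replicate l.length true) ∈ L
          · rw [if_pos]
            · simp [s, List.replicate_succ, ← hL, h']
            · intro t ht
              rw [List.length_append, List.length_singleton, Nat.lt_succ_iff_lt_or_eq] at ht
              rcases ht with ht | rfl
              · exact h t ht
              · exact h'
          · rw [if_neg fun H => h' (H _ (by simp))]
            simp [s, List.replicate_succ, ← hL, h']
        · rw [if_neg h, if_neg fun H => h fun t ht => H t (by simp; omega)]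
          simp [s]
    rw [key]
    by_cases h : ∀ t < (f x).length, pair x (List.replicate t true) ∈ L
    · rw [if_pos h]
      simpa [List.replicate_succ] using h
    · rw [if_neg h]
      simpa using h

end DP

/-! ### The quantifier hierarchy and its closure properties -/

/-- The polynomial hierarchy, defined by alternating polynomially bounded quantifiers. -/
def QS : ℕ → Set (Set (List Bool))
  | 0 => DP
  | n + 1 => {L | ∃ R ∈ QS n, ∃ p : Polynomial ℕ,
      (∀ x ∈ L, ∃ y, y.length ≤ p.eval x.length ∧ pair x y ∉ R) ∧ ∀ x y, pair x y ∉ R → x ∈ L}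

namespace QS

variable {n m : ℕ} {L L' R : Set (List Bool)} {f g : List Bool → List Bool}

theorem preimage (hL : L ∈ QS n) (hf : FP f) : {x | f x ∈ L} ∈ QS n := by
  induction n generalizing L f with
  | zero => exact DP.preimage hL hf
  | succ n ih =>
    obtain ⟨R, hR, p, h1, h2⟩ := hL
    obtain ⟨q, hq⟩ := hf.exists_length_le
    refine ⟨_, ih hR ((hf.comp .fst).pair .snd), p.comp q, fun x hx => ?_, fun x y h => ?_⟩
    · obtain ⟨y, hy, h⟩ := h1 _ hx
      refine ⟨y, ?_, by simpa using h⟩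
      rw [Polynomial.eval_comp]
      exact hy.trans (eval_mono p (hq x))
    · exact h2 (f x) y (by simpa using h)

/-- A dummy quantifier suffices, because the matrix in `QS` occurs negated. -/
theorem compl_mem_succ (hL : L ∈ QS n) : Lᶜ ∈ QS (n + 1) :=
  ⟨_, preimage hL .fst, 0, fun x hx => ⟨[], by simp, by simpa using hx⟩,
    fun x y h => by simpa using h⟩

theorem mem_succ (hL : L ∈ QS n) : L ∈ QS (n + 1) := by
  induction n generalizing L with
  | zero => simpa using compl_mem_succ (n := 0) (DP.compl hL)
  | succ n ih =>
    obtain ⟨R, hR, p, h1, h2⟩ := hL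
    exact ⟨R, ih hR, p, h1, h2⟩

theorem mono (hL : L ∈ QS n) (h : n ≤ m) : L ∈ QS m := by
  induction m, h using Nat.le_induction with
  | base => exact hL
  | succ m _ ih => exact mem_succ ih

theorem compl_mem (hL : L ∈ QS n) (h : n < m) : Lᶜ ∈ QS m :=
  mono (compl_mem_succ hL) h

theorem of_DP (hL : L ∈ DP) : L ∈ QS n :=
  mono (n := 0) hL (Nat.zero_le n)

/-- The two claims are proved together: negating the matrix exchanges intersection and union, so
each claim needs the other one a level below. -/
theorem inter_union (hL : L ∈ QS n) (hL' : L' ∈ QS n) : L ∩ L' ∈ QS n ∧ L ∪ L' ∈ QS n := by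
  induction n generalizing L L' with
  | zero => exact ⟨DP.inter hL hL', DP.union hL hL'⟩
  | succ n ih =>
    obtain ⟨R, hR, p, h1, h2⟩ := hL
    obtain ⟨R', hR', p', h1', h2'⟩ := hL'
    have hf := FP.fst.pair (FP.fst.comp FP.snd)
    have hg := FP.fst.pair (FP.snd.comp FP.snd)
    have len (x y y' : List Bool) (h : y.length ≤ p.eval x.length)
        (h' : y'.length ≤ p'.eval x.length) :
        (pair y y').length ≤ (2 * p + 1 + p').eval x.length := by
      simp
      omega
    refine ⟨⟨_, (ih (preimage hR hf) (preimage hR' hg)).2, 2 * p + 1 + p', fun x hx => ?_,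
      fun x z h => ?_⟩, ⟨_, (ih (preimage hR hf) (preimage hR' hg)).1, 2 * p + 1 + p',
      fun x hx => ?_, fun x z h => ?_⟩⟩
    · obtain ⟨y, hy, h⟩ := h1 x hx.1
      obtain ⟨y', hy', h'⟩ := h1' x hx.2
      exact ⟨pair y y', len x y y' hy hy', by simpa using ⟨h, h'⟩⟩
    · simp only [unpair_pair, Set.mem_union, Set.mem_ofPred_eq, not_or] at h
      exact ⟨h2 _ _ h.1, h2' _ _ h.2⟩
    · rcases hx with hx | hx
      · obtain ⟨y, hy, h⟩ := h1 x hx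
        exact ⟨pair y [], len x y [] hy (by simp), by simp [h]⟩
      · obtain ⟨y, hy, h⟩ := h1' x hx
        exact ⟨pair [] y, len x [] y (by simp) hy, by simp [h]⟩
    · simp only [unpair_pair, Set.mem_inter_iff, Set.mem_ofPred_eq, not_and_or] at h
      exact h.imp (h2 _ _) (h2' _ _)

theorem inter (hL : L ∈ QS n) (hL' : L' ∈ QS n) : L ∩ L' ∈ QS n := (inter_union hL hL').1

theorem union (hL : L ∈ QS n) (hL' : L' ∈ QS n) : L ∪ L' ∈ QS n := (inter_union hL hL').2

/-- Two consecutive existential quantifiers merge into one over pairs. -/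
theorem of_exists (hR : R ∈ QS (n + 1)) (p : Polynomial ℕ)
    (h1 : ∀ x ∈ L, ∃ y, y.length ≤ p.eval x.length ∧ pair x y ∈ R)
    (h2 : ∀ x y, pair x y ∈ R → x ∈ L) : L ∈ QS (n + 1) := by
  obtain ⟨R', hR', p', h1', h2'⟩ := hR
  refine ⟨_, preimage hR' ((FP.fst.pair (FP.fst.comp FP.snd)).pair (FP.snd.comp FP.snd)),
    2 * p + 1 + p'.comp (2 * .X + 1 + p), fun x hx => ?_, fun x z h => ?_⟩
  · obtain ⟨y, hy, h⟩ := h1 x hx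
    obtain ⟨y', hy', h'⟩ := h1' _ h
    refine ⟨pair y y', ?_, by simpa using h'⟩
    have := eval_mono p' (show (pair x y).length ≤ 2 * x.length + 1 + p.eval x.length by
      rw [length_pair]; omega)
    simp [Polynomial.eval_comp]
    omega
  · exact h2 _ _ (h2' _ _ (by simpa using h))

theorem length_le_eval (p : Polynomial ℕ) (hf : FP f) (hg : FP g) :
    {x | (f x).length ≤ p.eval (g x).length} ∈ QS n := by
  simpa using of_DP (n := n) (DP.length_le hf (hg.replicate_eval p))

/-- The length check goes into the matrix, because `of_exists` lets every word satisfying the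
matrix, however long, witness membership. -/
theorem exists_le (hR : R ∈ QS (n + 1)) (p : Polynomial ℕ) :
    {x | ∃ y, y.length ≤ p.eval x.length ∧ pair x y ∈ R} ∈ QS (n + 1) := by
  refine of_exists (inter hR (length_le_eval p FP.snd FP.fst)) p (fun x hx => ?_) fun x y h => ?_
  · obtain ⟨y, hy, h⟩ := hx
    exact ⟨y, hy, h, by simpa using hy⟩
  · exact ⟨y, by simpa using h.2, h.1⟩

theorem exists_lt (hL : L ∈ QS n) (hf : FP f) :
    {x | ∃ t < (f x).length, pair x (List.replicate t true) ∈ L} ∈ QS n := by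
  cases n with
  | zero =>
    have := DP.compl (DP.forall_lt (DP.compl hL) hf)
    refine cast (congrArg (· ∈ QS 0) ?_) this
    ext x
    simp
  | succ n =>
    obtain ⟨q, hq⟩ := hf.exists_length_le
    refine of_exists (R := {z | pair (unpair z).1 (List.replicate (unpair z).2.length true) ∈ L} ∩
      {z | (true :: (unpair z).2).length ≤ (f (unpair z).1).length}) (inter (preimage hL
      (FP.fst.pair ?_)) (of_DP (DP.length_le (FP.snd.cons true) (hf.comp FP.fst)))) q
      (fun x hx => ?_) (fun x y h => ?_)
    · simpa using FP.snd.replicate_append (.const [])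
    · obtain ⟨t, ht, h⟩ := hx
      exact ⟨List.replicate t true, by simpa using ht.le.trans (hq x), by simpa using h,
        by simpa using ht⟩
    · simp only [Set.mem_inter_iff, Set.mem_ofPred_eq, unpair_pair, List.length_cons] at h
      exact ⟨_, h.2, h.1⟩

/-- Above level zero this is collection: witnesses for all `t` are coded in a single word, and the
quantifier over `t`, now inside the negated matrix, is treated by `exists_lt` one level below. -/
theorem forall_lt (hL : L ∈ QS n) (hf : FP f) :
    {x | ∀ t < (f x).length, pair x (List.replicate t true) ∈ L} ∈ QS n := by
  cases n with
  | zero => exact DP.forall_lt hL hf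
  | succ n =>
    obtain ⟨q, hq⟩ := hf.exists_length_le
    obtain ⟨R, hR, p, h1, h2⟩ := hL
    have hL' := preimage hR (((FP.fst.comp FP.fst).pair FP.snd).pair
      (FP.snd.nthWord (FP.snd.comp FP.fst)))
    refine ⟨_, exists_lt hL' (hf.comp FP.fst), q * (2 * p.comp (2 * .X + 1 + q) + 1),
      fun x hx => ?_, fun x z h t ht => ?_⟩
    · have hx' : ∀ t : Fin (f x).length, ∃ y : List Bool,
          y.length ≤ p.eval (2 * x.length + 1 + q.eval x.length) ∧
            pair (pair x (List.replicate t true)) y ∉ R := by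
        intro t
        obtain ⟨y, hy, h⟩ := h1 _ (hx t t.2)
        refine ⟨y, hy.trans (eval_mono p ?_), h⟩
        have h3 := t.2
        have h4 := hq x
        simp
        omega
      choose y hy h using hx'
      refine ⟨codeList (List.ofFn y), ?_, ?_⟩
      · refine (length_codeList_le _ (p.eval (2 * x.length + 1 + q.eval x.length)) ?_).trans ?_
        · simpa [List.mem_ofFn] using hy
        · simpa [Polynomial.eval_comp] using hq x
      · simp only [Set.mem_ofPred_eq, unpair_pair, not_exists, not_and]
        intro t ht
        rw [List.length_replicate, nthWord_codeList _ _ (by simpa using ht)]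
        simpa using h ⟨t, ht⟩
    · simp only [Set.mem_ofPred_eq, unpair_pair, not_exists, not_and] at h
      exact h2 _ _ (h t ht)

end QS

theorem FP.reverse_append {f g : List Bool → List Bool} (hf : FP f) (hg : FP g) :
    FP fun x => (f x).reverse ++ g x := by
  have := foldl hf hg (s := fun _ b acc => b :: acc) (fun b => snd.cons b) 1 (by simp)
  refine cast (congrArg FP (funext fun x => ?_)) this
  have key : ∀ l u : List Bool, l.foldl (fun acc b => b :: acc) u = l.reverse ++ u := by
    intro l
    induction l with
    | nil => simp
    | cons b l ih => simp [ih]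
  exact key _ _

theorem FP.reverse {f : List Bool → List Bool} (hf : FP f) : FP fun x => (f x).reverse := by
  simpa using hf.reverse_append (.const [])

theorem FP.append {f g : List Bool → List Bool} (hf : FP f) (hg : FP g) :
    FP fun x => f x ++ g x := by
  simpa using hf.reverse.reverse_append hg

theorem FP.take {f g : List Bool → List Bool} (hf : FP f) (hg : FP g) :
    FP fun x => (g x).take (f x).length := by
  -- What `drop` leaves over is as long as the part to be cut off at the end of `g x`, that is, at
  -- the beginning of its reverse.
  refine cast (congrArg FP (funext fun x => ?_)) ((hf.drop hg).drop hg.reverse).reverse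
  rw [List.drop_reverse, List.reverse_reverse, List.length_drop]
  rcases le_total (f x).length (g x).length with h | h
  · rw [Nat.sub_sub_self h]
  · rw [List.take_of_length_le h, List.take_of_length_le (by omega)]

theorem QS.forall_finite {ι : Type} [Finite ι] {n : ℕ} {L : ι → Set (List Bool)}
    (hL : ∀ i, L i ∈ QS n) : {x | ∀ i, x ∈ L i} ∈ QS n := by
  classical
  cases nonempty_fintype ι
  have : ∀ s : Finset ι, {x | ∀ i ∈ s, x ∈ L i} ∈ QS n := by
    intro s
    induction s using Finset.induction_on with
    | empty => simpa using QS.of_DP (DP.const True)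
    | insert i s _ ih =>
      refine cast (congrArg (· ∈ QS n) ?_) (QS.inter (hL i) ih)
      ext x
      simp
  simpa using this Finset.univ

/-! ### Runs described by their choices and oracle answers -/

namespace OracleTM

variable {ι : Type} (M : OracleTM ι)

section Runs

variable {M} {O : ι → Set (List Bool)} {ρ : ℕ → Bool} {x : List Bool}

theorem run_eq_of_halt {a : Bool} {s t : ℕ} (h : M.action (M.run O ρ x s).state = .halt a)
    (hst : s ≤ t) : M.run O ρ x t = M.run O ρ x s := by
  induction t, hst using Nat.le_induction with
  | base => rfl
  | succ t _ ih => rw [run, ih, next, h]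

theorem halt_unique {a b : Bool} {s t : ℕ} (h : M.action (M.run O ρ x s).state = .halt a)
    (h' : M.action (M.run O ρ x t).state = .halt b) : a = b := by
  rcases le_total s t with hst | hst
  · rw [run_eq_of_halt h hst, h] at h'
    simpa using h'
  · rw [run_eq_of_halt h' hst, h'] at h
    simpa using h.symm

theorem Deterministic.run_eq (hM : M.Deterministic) (ρ ρ' : ℕ → Bool) (t : ℕ) :
    M.run O ρ x t = M.run O ρ' x t := by
  induction t with
  | zero => rfl
  | succ t ih =>
    rw [run, run, ih]
    rcases h : M.action (M.run O ρ' x t).state with a | ⟨i, q⟩ | δ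
    · simp only [next, h]
    · simp only [next, h]
    · have hδ := hM _ _ h
      have hb : ∀ b, δ b = δ true := fun b => by cases b <;> simp [hδ]
      simp only [next, h, hb (ρ t), hb (ρ' t)]

end Runs

open Classical in
/-- The answer to the query in the configuration `c`, or the choice `b` if there is no query. -/
noncomputable def bit (O : ι → Set (List Bool)) (b : Bool) (c : M.Cfg) : Bool :=
  match M.action c.state with
  | .query i _ => decide (tapeWord (c.tape M.queryTape) ∈ O i)
  | _ => b

theorem next_eq_bitNext (O : ι → Set (List Bool)) (b : Bool) (c : M.Cfg) :
    M.next O b c = M.bitNext (M.bit O b c) c := by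
  rcases h : M.action c.state with a | ⟨i, q⟩ | δ
  · simp only [next, bitNext, h]
  · simp only [next, bitNext, bit, h]
  · simp only [next, bitNext, bit, h]
    rfl

/-- The choices and answers in the first `n` steps. -/
noncomputable def bits (O : ι → Set (List Bool)) (ρ : ℕ → Bool) (x : List Bool) (n : ℕ) :
    List Bool :=
  (List.range n).map fun t => M.bit O (ρ t) (M.run O ρ x t)

theorem bitRun_bits (O : ι → Set (List Bool)) (ρ : ℕ → Bool) (x : List Bool) (n : ℕ) :
    M.bitRun x (M.bits O ρ x n) = M.run O ρ x n := by
  induction n with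
  | zero => rfl
  | succ n ih =>
    rw [bits, List.range_succ, List.map_append, bitRun, List.foldl_append]
    change M.bitNext _ (M.bitRun x (M.bits O ρ x n)) = _
    rw [ih, run, next_eq_bitNext]

theorem take_bits (O : ι → Set (List Bool)) (ρ : ℕ → Bool) (x : List Bool) {m n : ℕ}
    (h : m ≤ n) : (M.bits O ρ x n).take m = M.bits O ρ x m := by
  rw [bits, bits, ← List.map_take, List.take_range, min_eq_left h]

/-- When the choices and answers are the bits of `r`, each query to oracle `i` with answer `a` is
about a word in `G i a`. -/
def Valid (G : ι → Bool → Set (List Bool)) (x r : List Bool) : Prop :=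
  ∀ t < r.length, ∀ i, (∃ q, M.action (M.bitRun x (r.take t)).state = .query i q) →
    tapeWord ((M.bitRun x (r.take t)).tape M.queryTape) ∈ G i (r.getD t false)

/-- The inputs on which `M` halts with result `b` for valid choices and answers. -/
def validLang (G : ι → Bool → Set (List Bool)) (b : Bool) : Set (List Bool) :=
  {x | ∃ r, M.Valid G x r ∧ M.action (M.bitRun x r).state = .halt b}

variable {M}

theorem Valid.take {G : ι → Bool → Set (List Bool)} {x r : List Bool} (h : M.Valid G x r) (m : ℕ) :
    M.Valid G x (r.take m) := by
  intro t ht i hi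
  rw [List.length_take, lt_min_iff] at ht
  rw [List.take_take, min_eq_left ht.1.le] at hi ⊢
  have := h t ht.2 i hi
  have e : (r.take m).getD t false = r.getD t false := by
    simp [ht.1]
  rwa [e]

/-- The assumption on `G` makes every certified answer correct for the oracles `G i true`, so valid
bits describe an actual run. Since `G i false` may be smaller than the complement, actual runs need
not be valid. -/
theorem Valid.bitRun_eq {G : ι → Bool → Set (List Bool)} {x r : List Bool} (h : M.Valid G x r)
    (hG : ∀ i, G i false ⊆ (G i true)ᶜ) {t : ℕ} (ht : t ≤ r.length) :
    M.bitRun x (r.take t) = M.run (fun i => G i true) (fun t => r.getD t false) x t := by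
  classical
  induction t with
  | zero => simp [bitRun, run]
  | succ t ih =>
    have ih := ih (by omega)
    rw [List.take_succ_eq_append_getElem (by omega), bitRun, List.foldl_append]
    change M.bitNext _ (M.bitRun x (r.take t)) = _
    rw [ih, run, next_eq_bitNext]
    congr 1
    have hv := h t (by omega)
    rw [ih] at hv
    generalize M.run _ _ x t = c at hv ⊢
    rw [List.getD_eq_getElem _ _ (by omega)] at hv ⊢
    rcases hc : M.action c.state with a | ⟨i, q⟩ | δ
    · simp only [bit, hc]
    · simp only [bit, hc]
      have := hv i ⟨q, hc⟩
      rcases hr : r[t] with _ | _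
      · rw [hr] at this
        exact (decide_eq_false (hG i this)).symm
      · rw [hr] at this
        exact (decide_eq_true this).symm
    · simp only [bit, hc]

theorem mem_validLang_iff {O : ι → Set (List Bool)} {b : Bool} {x : List Bool} :
    x ∈ M.validLang (fun i a => if a then O i else (O i)ᶜ) b ↔
      ∃ ρ t, M.action (M.run O ρ x t).state = .halt b := by
  classical
  constructor
  · rintro ⟨r, hr, h⟩
    refine ⟨fun t => r.getD t false, r.length, ?_⟩
    have := hr.bitRun_eq (fun i => by simp) le_rfl
    simp only [List.take_length, if_true] at this
    rwa [← this]
  · rintro ⟨ρ, n, h⟩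
    refine ⟨M.bits O ρ x n, fun t ht i hi => ?_, by rwa [bitRun_bits]⟩
    have ht' : t < n := by simpa [bits] using ht
    rw [take_bits _ _ _ _ ht'.le, bitRun_bits] at hi ⊢
    obtain ⟨q, hq⟩ := hi
    have : (M.bits O ρ x n).getD t false =
        decide (tapeWord ((M.run O ρ x t).tape M.queryTape) ∈ O i) := by
      rw [List.getD_eq_getElem _ _ ht]
      simp [bits, bit, hq]
    rw [this]
    by_cases hO : tapeWord ((M.run O ρ x t).tape M.queryTape) ∈ O i <;> simp [hO]

/-- Valid bits describe an actual run, which halts in polynomial time; bits after that moment can be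
cut off without changing the verdict. -/
theorem exists_short_of_mem_validLang (hM : M.PolyTime) :
    ∃ p : Polynomial ℕ, ∀ (G : ι → Bool → Set (List Bool)) (b : Bool) (x : List Bool),
      (∀ i, G i false ⊆ (G i true)ᶜ) → x ∈ M.validLang G b →
      ∃ r, r.length ≤ p.eval x.length ∧ M.Valid G x r ∧ M.action (M.bitRun x r).state = .halt b := by
  obtain ⟨p, hp⟩ := hM
  refine ⟨p, fun G b x hG ⟨r, hr, h⟩ => ?_⟩
  obtain ⟨t, ht, a, ha⟩ := hp (fun i => G i true) (fun t => r.getD t false) x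
  rcases le_total t r.length with htr | htr
  · refine ⟨r.take t, by simp [ht], hr.take t, ?_⟩
    have h1 := hr.bitRun_eq hG le_rfl
    rw [List.take_length] at h1
    rw [h1] at h
    rw [hr.bitRun_eq hG htr, ha, halt_unique ha h]
  · exact ⟨r, htr.trans ht, hr, h⟩

variable (M)

/-- The bits of a run are guessed, the simulation is polynomial-time, and certifying the answers at
all times is a bounded universal quantifier, absorbed by `QS.forall_lt`. -/
theorem validLang_mem_QS [Finite ι] (hM : M.PolyTime) {n : ℕ} {G : ι → Bool → Set (List Bool)}
    (hG : ∀ i a, G i a ∈ QS (n + 1)) (hd : ∀ i, G i false ⊆ (G i true)ᶜ) (b : Bool) :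
    M.validLang G b ∈ QS (n + 1) := by
  classical
  obtain ⟨p, hp⟩ := exists_short_of_mem_validLang hM
  let κ (i : ι) (q : M.Q) : Bool := decide (∃ q', M.action q = .query i q')
  let s (i : ι) (w : List Bool) : List Bool := M.status (κ i) (pair (unpair (unpair w).1).1
    ((unpair (unpair w).1).2.take (unpair w).2.length))
  have hs (i) : FP (s i) := (M.fp_status (κ i)).comp
    ((FP.fst.comp .fst).pair (FP.snd.take (FP.snd.comp .fst)))
  -- Validity at a single time `t`, given in unary. The required set depends on the oracle and the
  -- answer, hence a conjunction over these finitely many cases.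
  obtain ⟨U, hU, hUV⟩ : ∃ U ∈ QS (n + 1), ∀ x r t, t < r.length →
      (pair (pair x r) (List.replicate t true) ∈ U ↔
        ∀ i, (∃ q, M.action (M.bitRun x (r.take t)).state = .query i q) →
          tapeWord ((M.bitRun x (r.take t)).tape M.queryTape) ∈ G i (r.getD t false)) := by
    refine ⟨{w | ∀ ia : ι × Bool, w ∈ {w | (s ia.1 w).head? = some true}ᶜ ∪
      {w | (((unpair (unpair w).1).2.drop (unpair w).2.length).head? = some true ↔ ia.2 = true)}ᶜ ∪
      {w | (s ia.1 w).tail ∈ G ia.1 ia.2}}, ?_, fun x r t ht => ?_⟩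
    · refine QS.forall_finite fun ⟨i, a⟩ => QS.union (QS.of_DP (DP.union (DP.compl
        (DP.of_head (hs i))) (DP.compl ?_))) (QS.preimage (hG i a) (FP.tail.comp (hs i)))
      have := DP.of_head (FP.snd.drop (FP.snd.comp .fst))
      cases a
      · simpa [Set.compl_def] using DP.compl this
      · simpa using this
    · have hr : ((r.drop t).head? = some true) ↔ r.getD t false = true := by
        simp [List.head?_drop, ht]
      simp only [Set.mem_ofPred_eq, Set.mem_union, Set.mem_compl_iff, s, status, unpair_pair, κ,
        List.length_replicate, List.head?_cons, List.tail_cons, Option.some.injEq,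
        decide_eq_true_eq, hr, ← Bool.eq_iff_iff, Prod.forall]
      constructor
      · intro h i hi
        simpa [hi] using h i (r.getD t false)
      · intro h i a
        by_cases hi : ∃ q, M.action (M.bitRun x (r.take t)).state = .query i q
        · by_cases ha : r.getD t false = a
          · exact .inr (ha ▸ h i hi)
          · exact .inl (.inr ha)
        · exact .inl (.inl hi)
  have key (x r : List Bool) : pair x r ∈
      {z | ∀ t < (unpair z).2.length, pair z (List.replicate t true) ∈ U} ∩
        {z | (M.status (fun q => decide (M.action q = .halt b)) z).head? = some true} ↔
      M.Valid G x r ∧ M.action (M.bitRun x r).state = .halt b := by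
    simp only [Set.mem_inter_iff, Set.mem_ofPred_eq, unpair_pair, status, List.head?_cons,
      Option.some.injEq, decide_eq_true_eq, Valid]
    exact and_congr_left' (forall₂_congr fun t ht => hUV x r t ht)
  refine QS.of_exists (QS.inter (QS.forall_lt hU FP.snd) (QS.of_DP (DP.of_head (M.fp_status _)))) p
    (fun x hx => ?_) fun x r h => ⟨r, (key x r).1 h⟩
  obtain ⟨r, hr, h⟩ := hp G b x hd hx
  exact ⟨r, hr, (key x r).2 h⟩

theorem lang_mem_QS [Finite ι] (hM : M.PolyTime) {n : ℕ} {O : ι → Set (List Bool)}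
    (hO : ∀ i, O i ∈ QS n) (b : Bool) :
    {x | ∃ ρ t, M.action (M.run O ρ x t).state = .halt b} ∈ QS (n + 1) := by
  have := M.validLang_mem_QS hM (G := fun i a => if a then O i else (O i)ᶜ) (n := n)
    (fun i a => by
      cases a
      · simpa using QS.compl_mem_succ (hO i)
      · simpa using QS.mem_succ (hO i)) (fun i => by simp) b
  refine cast (congrArg (· ∈ QS (n + 1)) ?_) this
  ext x
  exact mem_validLang_iff

end OracleTM

/-! ### Agreement of the machine and quantifier hierarchies -/

theorem P_eq_DP : P = DP := by
  classical
  refine Set.Subset.antisymm ?_ DP_subset_P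
  rintro L ⟨M, hM, ⟨p, hp⟩, rfl⟩
  refine ⟨_, (M.fp_status fun q => decide (M.action q = .halt true)).comp
    (FP.id.pair (FP.replicate_eval p .id)), fun x => ?_⟩
  -- Without oracles the bits are just the choices, and constant choices are known in advance.
  have h : M.bits Empty.elim (fun _ => true) x (p.eval x.length) =
      List.replicate (p.eval x.length) true := by
    rw [List.eq_replicate_iff]
    refine ⟨by simp [OracleTM.bits], fun b hb => ?_⟩
    obtain ⟨t, -, rfl⟩ := List.mem_map.1 hb
    rw [OracleTM.bit]
    rcases M.action (M.run Empty.elim (fun _ => true) x t).state with a | ⟨⟨⟩, q⟩ | δ <;> rfl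
  simp only [OracleTM.status, unpair_pair, List.head?_cons, ← h, OracleTM.bitRun_bits,
    Option.some.injEq, decide_eq_true_eq]
  obtain ⟨t, ht, a, ha⟩ := hp Empty.elim (fun _ => true) x
  have hrun := OracleTM.run_eq_of_halt ha ht
  constructor
  · rintro ⟨ρ, s, hs⟩
    rw [hM.run_eq _ fun _ => true] at hs
    rw [hrun, ha, OracleTM.halt_unique ha hs]
  · intro h
    exact ⟨_, _, h⟩

theorem NPRel_QS (n : ℕ) : NPRel (QS n) = QS (n + 1) := by
  refine Set.Subset.antisymm ?_ ?_
  · rintro L ⟨C, hC, M, hM, rfl⟩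
    exact M.lang_mem_QS hM (fun _ => hC) true
  · rintro L ⟨R, hR, p, h1, h2⟩
    refine mem_NPRel_of_forall (QS.preimage hR (FP.snd.pair (FP.fst.comp .fst)))
      (FP.replicate_eval (2 * p + 1) .id) fun x => ⟨fun hx => ?_, ?_⟩
    · obtain ⟨y, hy, h⟩ := h1 x hx
      -- Padding brings the guess to length exactly `2 * p + 1`.
      refine ⟨pair y (List.replicate (2 * (p.eval x.length - y.length)) true), ?_, by simpa using h⟩
      simp
      omega
    · rintro ⟨g, -, h⟩
      exact h2 x (unpair g).1 (by simpa using h)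

theorem SigmaP_eq_QS (n : ℕ) : SigmaP n = QS n := by
  induction n with
  | zero => exact P_eq_DP
  | succ n ih => rw [SigmaP, ih, NPRel_QS]

/-! ### Self-reducibility and the replacement of inner quantifiers -/

/-- The pairs of a word `w` and a suffix of a word `y` of length at most `p |w|` such that `(w, y)`
is in `T`. -/
def suffixes (T : Set (List Bool)) (p : Polynomial ℕ) : Set (List Bool) :=
  {z | ∃ v, (v ++ (unpair z).2).length ≤ p.eval (unpair z).1.length ∧
    pair (unpair z).1 (v ++ (unpair z).2) ∈ T}

theorem pair_mem_suffixes {T : Set (List Bool)} {p : Polynomial ℕ} {w u : List Bool} :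
    pair w u ∈ suffixes T p ↔ ∃ v, (v ++ u).length ≤ p.eval w.length ∧ pair w (v ++ u) ∈ T := by
  simp [suffixes]

namespace QS

variable {j n : ℕ} {B L T : Set (List Bool)}

theorem eval_le_length (p : Polynomial ℕ) {f g : List Bool → List Bool} (hf : FP f) (hg : FP g) :
    {x | p.eval (g x).length ≤ (f x).length} ∈ QS n := by
  simpa using of_DP (n := n) (DP.length_le (hg.replicate_eval p) hf)

theorem suffixes_mem (hT : Tᶜ ∈ QS j) (p : Polynomial ℕ) : suffixes T p ∈ QS (j + 1) := by
  have hf := FP.snd.append (FP.snd.comp .fst)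
  refine of_exists (inter (length_le_eval p hf (FP.fst.comp .fst))
    (preimage (by simpa using compl_mem_succ hT) ((FP.fst.comp .fst).pair hf))) p
    (fun x ⟨v, h1, h2⟩ => ⟨v, ?_, by simpa using h1, by simpa using h2⟩)
    fun x v h => ⟨v, by simpa using h⟩
  have h3 := eval_mono p (show (unpair x).1.length ≤ x.length by
    have := length_unpair x
    omega)
  simp only [List.length_append] at h1
  omega

/-- Induction on the quantifiers outside level `j + 1`. At the bottom `L` itself is a question to
`suffixes T p`, and `B` has both sides in `QS (j + 1)`. Each further existential quantifier is
absorbed by the complement of `R'`, so `L'` stays one level lower than `L`, and one level up both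
sides are available. The polynomial `m` bounds the words asked about. -/
theorem exists_replacement (hjn : j ≤ n) (hL : L ∈ QS (n + 1)) :
    ∃ T, Tᶜ ∈ QS j ∧ ∃ p m : Polynomial ℕ, ∀ B ∈ QS (j + 1), Bᶜ ∈ QS (j + 1) →
      ∃ L' ∈ QS (n + 1), L'ᶜ ∈ QS (n + 1) ∧ ∀ x y,
        (∀ w : List Bool, w.length ≤ m.eval x.length →
          (pair w [] ∈ suffixes T p ↔ pair (pair w []) y ∈ B)) → (x ∈ L ↔ pair x y ∈ L') := by
  induction n, hjn using Nat.le_induction generalizing L with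
  | base =>
    obtain ⟨R, hR, p, h1, h2⟩ := hL
    refine ⟨Rᶜ, by simpa using hR, p, .X, fun B hB hB' => ?_⟩
    have hf := (FP.fst.pair (.const [])).pair FP.snd
    refine ⟨_, preimage hB hf, preimage hB' hf, fun x y h => ?_⟩
    have h := h x (by simp)
    simp only [Set.mem_ofPred_eq, unpair_pair, ← h, pair_mem_suffixes, List.append_nil]
    exact ⟨h1 x, fun ⟨v, _, h⟩ => h2 x v h⟩
  | succ n hjn ih =>
    obtain ⟨R, hR, q, h1, h2⟩ := hL
    obtain ⟨T, hT, p, m, H⟩ := ih hR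
    refine ⟨T, hT, p, m.comp (2 * .X + 1 + q), fun B hB hB' => ?_⟩
    obtain ⟨R', -, hR'', h⟩ := H B hB hB'
    have hL' : {z | ∃ u, u.length ≤ q.eval (unpair z).1.length ∧
        pair (pair (unpair z).1 u) (unpair z).2 ∉ R'} ∈ QS (n + 1) := by
      refine of_exists (inter (length_le_eval q FP.snd (FP.fst.comp .fst)) (preimage hR''
        (((FP.fst.comp .fst).pair .snd).pair (FP.snd.comp .fst)))) q
        (fun x ⟨u, h1, h2⟩ => ⟨u, h1.trans (eval_mono q ?_), by simpa using h1, by simpa using h2⟩)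
        fun x u h => ⟨u, by simpa using h⟩
      have := length_unpair x
      omega
    refine ⟨_, mem_succ hL', compl_mem_succ hL', fun x y hxy => ?_⟩
    have key (u : List Bool) (hu : u.length ≤ q.eval x.length) :
        pair x u ∈ R ↔ pair (pair x u) y ∈ R' := by
      refine h _ y fun w hw => hxy w (hw.trans ?_)
      rw [Polynomial.eval_comp]
      refine eval_mono m ?_
      simpa using hu
    simp only [Set.mem_ofPred_eq, unpair_pair]
    constructor
    · intro hx
      obtain ⟨u, hu, h⟩ := h1 x hx
      exact ⟨u, hu, by rwa [← key u hu]⟩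
    · rintro ⟨u, hu, h⟩
      exact h2 x u (by rwa [key u hu])

/-- Comparing `B` with `suffixes T p` directly would cost a further alternation. A failure is
instead local: either a suffix is extendable but not in `B`, or it is in `B` although it is not in
`T` and is already of full length or has neither one-bit extension in `B`. Failures are in `QS (j +
1)`. -/
theorem forall_mem_suffixes_iff (hT : Tᶜ ∈ QS j) (hB : B ∈ QS (j + 1)) (hB' : Bᶜ ∈ QS (j + 1))
    (p m : Polynomial ℕ) :
    {x | ∀ w u : List Bool, w.length ≤ m.eval x.length → u.length ≤ p.eval w.length →
      (pair w u ∈ suffixes T p ↔ pair (pair w u) x ∈ B)} ∈ QS (j + 2) := by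
  have hw := FP.fst.comp FP.snd
  have hu := FP.snd.comp FP.snd
  have hx := FP.fst
  have hB₀ := preimage hB ((hw.pair hu).pair hx)
  have hB₁ := preimage hB' ((hw.pair hu).pair hx)
  have hS := preimage (suffixes_mem hT p) (hw.pair hu)
  have hb (b : Bool) := preimage hB' ((hw.pair (hu.cons b)).pair hx)
  have hbad := exists_le (inter (inter (length_le_eval m hw hx) (length_le_eval p hu hw))
    (union (inter hB₁ hS) (inter (inter hB₀ (preimage (mem_succ hT) (hw.pair hu)))
      (union (eval_le_length p hu hw) (inter (hb false) (hb true))))))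
      (2 * m + 1 + p.comp m)
  refine cast (congrArg (· ∈ QS (j + 2)) ?_) (compl_mem_succ hbad)
  ext x
  constructor
  · intro h
    have h (w u : List Bool) (hw : w.length ≤ m.eval x.length) (hu : u.length ≤ p.eval w.length) :
        (pair w u ∈ suffixes T p → pair (pair w u) x ∈ B) ∧ (pair (pair w u) x ∈ B →
          pair w u ∈ T ∨ u.length < p.eval w.length ∧ ∃ b, pair (pair w (b :: u)) x ∈ B) := by
      by_contra hn
      refine h ⟨pair w u, ?_, ?_⟩
      · have := hu.trans (eval_mono p hw)
        simp [Polynomial.eval_comp]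
        omega
      · simp only [Set.mem_inter_iff, Set.mem_union, Set.mem_ofPred_eq, unpair_pair,
          Set.mem_compl_iff]
        refine ⟨⟨hw, hu⟩, ?_⟩
        simp only [Bool.exists_bool] at hn
        rw [← not_lt]
        tauto
    intro w u hw hu
    -- Induction on the room left for extending `u`: local consistency leads from a suffix in `B` to
    -- longer ones in `B` until one lies in `T`.
    obtain ⟨d, hd⟩ : ∃ d, p.eval w.length - u.length = d := ⟨_, rfl⟩
    induction d generalizing u with
    | zero =>
      refine ⟨(h w u hw hu).1, fun hB => ?_⟩
      rcases (h w u hw hu).2 hB with hT | ⟨hlt, -⟩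
      · exact pair_mem_suffixes.2 ⟨[], hu, hT⟩
      · omega
    | succ d ih =>
      refine ⟨(h w u hw hu).1, fun hB => ?_⟩
      rcases (h w u hw hu).2 hB with hT | ⟨hlt, b, hb⟩
      · exact pair_mem_suffixes.2 ⟨[], hu, hT⟩
      · have hl : (b :: u).length = u.length + 1 := rfl
        obtain ⟨v, hv, hT⟩ :=
          pair_mem_suffixes.1 ((ih (b :: u) (by omega) (by omega)).2 hb)
        exact pair_mem_suffixes.2 ⟨v ++ [b], by simpa using hv, by simpa using hT⟩
  · rintro h ⟨y, -, hy⟩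
    simp only [Set.mem_inter_iff, Set.mem_union, Set.mem_ofPred_eq, unpair_pair,
      Set.mem_compl_iff] at hy
    obtain ⟨⟨hw, hu⟩, hy⟩ := hy
    rw [← h _ _ hw hu] at hy
    rcases hy with hy | ⟨⟨hS, hT⟩, hy⟩
    · exact hy.1 hy.2
    obtain ⟨v, hv, hvT⟩ := pair_mem_suffixes.1 hS
    rcases List.eq_nil_or_concat v with rfl | ⟨v, b, rfl⟩
    · exact hT hvT
    have hl : (b :: (unpair y).2).length ≤ p.eval (unpair y).1.length := by
      simp at hv ⊢
      omega
    have hb : pair (pair (unpair y).1 (b :: (unpair y).2)) x ∈ B :=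
      (h _ _ hw hl).1 (pair_mem_suffixes.2 ⟨v, by simpa using hv, by simpa using hvT⟩)
    rcases hy with hy | hy
    · simp at hl
      omega
    · cases b
      · exact hy.1 hb
      · exact hy.2 hb

end QS

/-! ### The easy-hard argument -/

namespace OracleTM

variable {ι : Type} {M : OracleTM ι} {O O' : ι → Set (List Bool)} {ρ : ℕ → Bool} {x : List Bool}

theorem run_congr (h : ∀ s i q, M.action (M.run O ρ x s).state = .query i q →
    (tapeWord ((M.run O ρ x s).tape M.queryTape) ∈ O i ↔
      tapeWord ((M.run O ρ x s).tape M.queryTape) ∈ O' i)) (t : ℕ) :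
    M.run O' ρ x t = M.run O ρ x t := by
  induction t with
  | zero => rfl
  | succ t ih =>
    rw [run, run, ih]
    rcases hc : M.action (M.run O ρ x t).state with a | ⟨i, q⟩ | δ
    · simp only [next, hc]
    · simp only [next, hc]
      congr 2
      exact decide_eq_decide.2 (h t i q hc).symm
    · simp only [next, hc]

theorem Deterministic.mem_lang_iff (hd : M.Deterministic) {a : Bool} {t : ℕ}
    (h : M.action (M.run O ρ x t).state = .halt a) : x ∈ M.lang O ↔ a = true := by
  constructor
  · rintro ⟨ρ', t', h'⟩
    rw [hd.run_eq ρ' ρ] at h'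
    exact halt_unique h h'
  · rintro rfl
    exact ⟨ρ, t, h⟩

theorem PolyTime.exists_halt (hp : M.PolyTime) (O : ι → Set (List Bool)) (ρ : ℕ → Bool)
    (x : List Bool) : ∃ t a, M.action (M.run O ρ x t).state = .halt a := by
  obtain ⟨p, hp⟩ := hp
  obtain ⟨t, -, a, h⟩ := hp O ρ x
  exact ⟨t, a, h⟩

/-- By determinism and totality, rejection too is the existence of a run. -/
theorem Deterministic.compl_lang_mem_QS [Finite ι] (hd : M.Deterministic) (hp : M.PolyTime) {n : ℕ}
    (hO : ∀ i, O i ∈ QS n) : (M.lang O)ᶜ ∈ QS (n + 1) := by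
  refine cast (congrArg (· ∈ QS (n + 1)) ?_) (M.lang_mem_QS hp hO false)
  ext x
  obtain ⟨t, a, h⟩ := hp.exists_halt O (fun _ => false) x
  rw [Set.mem_compl_iff, hd.mem_lang_iff h]
  constructor
  · rintro ⟨ρ', t', h'⟩
    rw [hd.run_eq ρ' fun _ => false] at h'
    simp [halt_unique h h']
  · intro ha
    exact ⟨_, t, by simpa [ha] using h⟩

end OracleTM

theorem QS.compl_mem_of_POrdered_eq {j n : ℕ} (hjn : j < n)
    (h : POrdered (QS j) (QS (n + 1)) = POrdered (QS (j + 1)) (QS (n + 1)))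
    {L : Set (List Bool)} (hL : L ∈ QS (n + 1)) : Lᶜ ∈ QS (n + 1) := by
  classical
  obtain ⟨T, hT, p, m, hrepl⟩ := QS.exists_replacement hjn.le hL
  set S := suffixes T p with hS_def
  have hS : S ∈ QS (j + 1) := QS.suffixes_mem hT p
  obtain ⟨C, hC, D, hD, M, hd, hp, hq, hX⟩ : {z | ¬ (z ∈ {z | (unpair z).1 ∈ S} ↔
      z ∈ {z | (unpair z).2 ∈ L})} ∈ POrdered (QS j) (QS (n + 1)) :=
    h ▸ xor_mem_POrdered (QS.preimage hS .fst) (QS.preimage hL .snd)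
  set O : Bool → Set (List Bool) := fun i => bif i then D else C with hO_def
  have hmem (φ x : List Bool) : pair φ x ∈ M.lang O ↔ ¬ (φ ∈ S ↔ x ∈ L) := by
    rw [← hX]
    simp
  -- The second oracle now always answers no, so only `C`, of level `j`, is left.
  set O' : Bool → Set (List Bool) := fun i => bif i then ∅ else C with hO'_def
  have hO' (i : Bool) : O' i ∈ QS j := by
    cases i
    · exact hC
    · exact QS.of_DP (DP.const False)
  have hB : M.lang O' ∈ QS (j + 1) := M.lang_mem_QS hp hO' true
  have hB' : (M.lang O')ᶜ ∈ QS (j + 1) := hd.compl_lang_mem_QS hp hO'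
  obtain ⟨L', hL', hL'c, hrepl⟩ := hrepl _ hB hB'
  -- Both answers of `C` can be certified, but only positive ones of `D`.
  let G (i a : Bool) : Set (List Bool) := if a then O i else bif i then ∅ else Cᶜ
  have hG (i a : Bool) : G i a ∈ QS (n + 1) := by
    rcases i with _ | _ <;> rcases a with _ | _
    · exact QS.compl_mem hC (by omega)
    · exact QS.mono hC (by omega)
    · exact QS.of_DP (DP.const False)
    · exact hD
  have hGd (i : Bool) : G i false ⊆ (G i true)ᶜ := by
    cases i <;> simp [G, O]
  -- The easy pairs: a certified verdict agrees with membership of the first component in `S`, which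
  -- excludes the second one from `L`.
  let E : Set (List Bool) := M.validLang G true ∩ {z | (unpair z).1 ∈ S} ∪
    M.validLang G false ∩ {z | (unpair z).1 ∈ Sᶜ}
  have hE : E ∈ QS (n + 1) := QS.union
    (QS.inter (M.validLang_mem_QS hp hG hGd true) (QS.preimage (QS.mono hS (by omega)) .fst))
    (QS.inter (M.validLang_mem_QS hp hG hGd false)
      (QS.preimage (QS.compl_mem hS (by omega)) .fst))
  have hvalid (a : Bool) (z : List Bool) (hz : z ∈ M.validLang G a) : z ∈ M.lang O ↔ a = true := by
    obtain ⟨r, hr, hra⟩ := hz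
    have := hr.bitRun_eq hGd le_rfl
    rw [List.take_length] at this
    rw [this] at hra
    exact hd.mem_lang_iff hra
  have sound (φ x : List Bool) (hφ : pair φ x ∈ E) : x ∉ L := by
    simp only [E, Set.mem_union, Set.mem_inter_iff, Set.mem_ofPred_eq, unpair_pair,
      Set.mem_compl_iff] at hφ
    rcases hφ with ⟨h1, h2⟩ | ⟨h1, h2⟩
    · have := hvalid _ _ h1
      rw [hmem] at this
      simpa [h2] using this
    · have := hvalid _ _ h1
      rw [hmem] at this
      simpa [h2] using this
  have hard (φ x : List Bool) (hx : x ∉ L) (hφ : pair φ x ∉ E) :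
      φ ∈ S ↔ pair φ x ∈ M.lang O' := by
    obtain ⟨t, a, ht⟩ := hp.exists_halt O (fun _ => false) (pair φ x)
    have ha : φ ∈ S ↔ a = true := by
      rw [← hd.mem_lang_iff ht, hmem]
      tauto
    suffices hrun : M.run O' (fun _ => false) (pair φ x) t = M.run O (fun _ => false) (pair φ x) t by
      rw [← hrun] at ht
      rw [ha, hd.mem_lang_iff ht]
    have hnv : pair φ x ∉ M.validLang G a := by
      intro hv
      apply hφ
      simp only [E, Set.mem_union, Set.mem_inter_iff, Set.mem_ofPred_eq, unpair_pair,
        Set.mem_compl_iff, ha]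
      cases a
      · exact .inr ⟨hv, by simp⟩
      · exact .inl ⟨hv, rfl⟩
    -- Otherwise the bits of the actual run would be valid: a negative answer of `D` is the only one
    -- without certificate.
    obtain ⟨t₀, q₀, hq₀, hw₀⟩ : ∃ t₀ q₀,
        M.action (M.run O (fun _ => false) (pair φ x) t₀).state = .query true q₀ ∧
        tapeWord ((M.run O (fun _ => false) (pair φ x) t₀).tape M.queryTape) ∉ D := by
      by_contra! hc
      refine hnv ⟨M.bits O (fun _ => false) (pair φ x) t, fun s hs i ⟨q, hi⟩ => ?_, ?_⟩
      · have hs' : s < t := by simpa [OracleTM.bits] using hs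
        rw [OracleTM.take_bits _ _ _ _ hs'.le, OracleTM.bitRun_bits] at hi ⊢
        have hb : (M.bits O (fun _ => false) (pair φ x) t).getD s false = decide (tapeWord
            ((M.run O (fun _ => false) (pair φ x) s).tape M.queryTape) ∈ O i) := by
          rw [List.getD_eq_getElem _ _ hs]
          simp [OracleTM.bits, OracleTM.bit, hi]
        rw [hb]
        cases i
        · by_cases hw : tapeWord ((M.run O (fun _ => false) (pair φ x) s).tape M.queryTape) ∈ C <;>
            simp [G, O, hw]
        · simp [G, O, hc s q hi]
      · rwa [OracleTM.bitRun_bits]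
    refine OracleTM.run_congr (fun s i q hi => ?_) t
    cases i
    · rfl
    · obtain rfl := (hq (fun _ => false) (pair φ x)).1 true s t₀ ⟨q, hi⟩ ⟨q₀, hq₀⟩
      simpa [O, O'] using hw₀
  -- Either some short pair is easy, or `B` passes the consistency check with advice `x` and (x, x)
  -- is outside `L'`. The bound `2 * m + 1 + p.comp m` covers all pairs `pair w u` that occur in the
  -- check.
  refine cast (congrArg (· ∈ QS (n + 1)) ?_) (QS.union
    (QS.exists_le (QS.preimage hE (FP.snd.pair .fst)) (2 * m + 1 + p.comp m))
    (QS.inter (QS.mono (QS.forall_mem_suffixes_iff hT hB hB' p m) (by omega))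
      (QS.preimage hL'c (FP.id.pair .id))))
  ext x
  simp only [Set.mem_union, Set.mem_inter_iff, Set.mem_ofPred_eq, unpair_pair, Set.mem_compl_iff]
  constructor
  · rintro (⟨φ, -, hφ⟩ | ⟨hx, hxL⟩)
    · exact sound φ x hφ
    · rwa [hrepl x x fun w hw => hx w [] hw (by simp)]
  · intro hx
    by_cases he : ∃ φ : List Bool, φ.length ≤ (2 * m + 1 + p.comp m).eval x.length ∧ pair φ x ∈ E
    · exact .inl he
    · have hc (w u : List Bool) (hw : w.length ≤ m.eval x.length) (hu : u.length ≤ p.eval w.length) :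
          pair w u ∈ S ↔ pair (pair w u) x ∈ M.lang O' := by
        refine hard _ x hx fun hφ => he ⟨_, ?_, hφ⟩
        have := hu.trans (eval_mono p hw)
        simp [Polynomial.eval_comp]
        omega
      exact .inr ⟨hc, by rwa [← hrepl x x fun w hw => hc w [] hw (by simp)]⟩

/-! ### Collapse of the hierarchy -/

/-- Once the negated matrix is itself in `QS (n + 1)`, the outer existential quantifier is absorbed.
-/
theorem QS.eq_of_compl_mem {n k : ℕ} (h : ∀ L ∈ QS (n + 1), Lᶜ ∈ QS (n + 1)) (hk : n + 1 ≤ k) :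
    QS k = QS (n + 1) := by
  induction k, hk using Nat.le_induction with
  | base => rfl
  | succ k _ ih =>
    refine Set.Subset.antisymm ?_ fun L hL => QS.mem_succ (ih ▸ hL)
    rintro L ⟨R, hR, p, h1, h2⟩
    exact QS.of_exists (h R (ih ▸ hR)) p h1 h2

end QueryOrder

theorem corollaryc (j k : ℕ) (hjk : j + 1 < k)
    (h : QueryOrder.POrdered (QueryOrder.SigmaP j) (QueryOrder.SigmaP k) =
      QueryOrder.POrdered (QueryOrder.SigmaP (j + 1)) (QueryOrder.SigmaP k)) :
    QueryOrder.SigmaP k = QueryOrder.PiP k ∧ QueryOrder.PiP k = QueryOrder.PH := by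
  open QueryOrder in
  obtain ⟨n, rfl⟩ : ∃ n, k = n + 1 := ⟨k - 1, by omega⟩
  simp only [SigmaP_eq_QS] at h
  have hc : ∀ L ∈ QS (n + 1), Lᶜ ∈ QS (n + 1) := fun L hL =>
    QS.compl_mem_of_POrdered_eq (by omega) h hL
  have hPi : SigmaP (n + 1) = PiP (n + 1) := by
    ext L
    rw [PiP, Set.mem_ofPred_eq, SigmaP_eq_QS]
    exact ⟨hc L, fun hL => compl_compl L ▸ hc _ hL⟩
  refine ⟨hPi, ?_⟩
  rw [← hPi, PH]
  refine Set.Subset.antisymm (Set.subset_iUnion SigmaP (n + 1)) (Set.iUnion_subset fun i => ?_)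
  rw [SigmaP_eq_QS, SigmaP_eq_QS]
  rcases le_total i (n + 1) with hi | hi
  · exact fun L hL => QS.mono hL hi
  · rw [QS.eq_of_compl_mem hc hi]
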